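/- Consider the stochastic bandit with $d$ arms and unknown mean vector $\mu\in\mathbb R^d$: in each round $t=1,2,\dots$ a strategy $\pi$ chooses an arm $I_t\in\{1,\dots,d\}$ based on the past arms and rewards (possibly with additional randomisation) and then receives a reward $X_t$ whose conditional law given the past and $I_t$ is $\mathcal N(\mu_{I_t},1)$. Write $\mu^*=\max_i\mu_i$, $\Delta_i=\mu^*-\mu_i$, and let $R^\pi_\mu(n)=\mathbb E\big[\sum_{t=1}^n(\mu^*-\mu_{I_t})\big]$ be the expected regret of $\pi$ up to horizon $n$. For $\nu\in\mathbb R$, $\sigma^2\ge 0$ and an integer $m\ge 1$ let $\theta\sim\mathcal N(\nu,\sigma^2)$ and, conditionally on $\theta$, let $Y_1,\dots,Y_m$ be independent with law $\mathcal N(\theta,1)$. The Gittins index is $$\gamma(\nu,\sigma^2,m)=\max\Big\{\gamma\in\mathbb R:\ \sup_{1\le\tau\le m}\mathbb E[(\theta-\gamma)\tau]\ge 0\Big\},$$ where the supremum is over stopping times $\tau$ with respect to the filtration generated by $Y_1,\dots,Y_m$. Fix a Gaussian prior with independent components $\mathcal N(\nu_i,\sigma_i^2)$, $i=1,\dots,d$.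 Let $T_i(t)=\sum_{s\le t}\mathbf 1\{I_s=i\}$ and let $$\nu_i(t)=\frac{\nu_i/\sigma_i^2+\sum_{s=1}^t\mathbf 1\{I_s=i\}X_s}{1/\sigma_i^2+T_i(t)},\qquad \sigma_i^2(t)=\Big(\frac1{\sigma_i^2}+T_i(t)\Big)^{-1}$$ be the posterior mean and variance of arm $i$ after round $t$. For each horizon $n$ let $\pi_n$ be a strategy that chooses $$I_t\in\operatorname*{arg\,max}_i\ \gamma\big(\nu_i(t-1),\sigma_i^2(t-1),n-t+1\big)\qquad (1\le t\le n),$$ with ties broken in any way. Theorem. There is a universal constant $c>0$ such that for every $d$, every prior with $\nu_i\in\mathbb R$ and $\sigma_i^2>0$ for all $i$, every such sequence of strategies $(\pi_n)_n$, and every $\mu\in\mathbb R^d$, $$\limsup_{n\to\infty}\frac{R^{\pi_n}_\mu(n)}{\log n}\ \le\ c\sum_{i:\Delta_i>0}\frac1{\Delta_i}.$$ -/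

import Mathlib

open MeasureTheory ProbabilityTheory Filter
open scoped NNReal

noncomputable section

namespace GaussianBandit

/-! ### The finite-horizon Gittins index -/

/-- The joint law of `(θ, (Y₁, …, Y_m))`, where `θ ∼ N(ν, v)` and, conditionally on `θ`, the rewards
`Y₁, …, Y_m` are independent with law `N(θ, 1)` (that is, `Y_s = θ + ξ_s` with independent standard
Gaussian `ξ_s`, also independent of `θ`). The reward `Y_{s+1}` is the coordinate `s : Fin m`. -/
def armLaw (ν : ℝ) (v : ℝ≥0) (m : ℕ) : Measure (ℝ × (Fin m → ℝ)) :=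
  ((gaussianReal ν v).prod (Measure.pi fun _ : Fin m => gaussianReal 0 1)).map
    fun p => (p.1, fun s => p.1 + p.2 s)

/-- The filtration generated by the rewards: at time `t` it is `σ(Y₁, …, Y_t)`. -/
def rewardFiltration (m : ℕ) :
    Filtration ℕ (inferInstance : MeasurableSpace (ℝ × (Fin m → ℝ))) where
  seq t := ⨆ (s : Fin m) (_ : (s : ℕ) < t),
    MeasurableSpace.comap (fun p : ℝ × (Fin m → ℝ) => p.2 s) inferInstance
  mono' := fun _ _ h => iSup_mono fun _ => iSup_mono' fun hs => ⟨hs.trans_le h, le_rfl⟩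
  le' := fun _ => iSup₂_le fun s _ =>
    ((measurable_pi_apply s).comp measurable_snd).comap_le

/-- Stopping times `τ` of the reward filtration with `1 ≤ τ ≤ m`. -/
structure IsAdmissible (m : ℕ) (τ : ℝ × (Fin m → ℝ) → ℕ) : Prop where
  isStoppingTime : IsStoppingTime (rewardFiltration m) fun p => (τ p : WithTop ℕ)
  one_le : ∀ p, 1 ≤ τ p
  le : ∀ p, τ p ≤ m

/-- `sup_{1 ≤ τ ≤ m} E[(θ - γ) τ]`, over stopping times of the reward filtration. -/
def stoppingValue (ν : ℝ) (v : ℝ≥0) (m : ℕ) (γ : ℝ) : ℝ :=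
  ⨆ τ : {τ : ℝ × (Fin m → ℝ) → ℕ // IsAdmissible m τ},
    ∫ p, (p.1 - γ) * (τ.1 p : ℝ) ∂(armLaw ν v m)

/-- The Gittins index `max {γ : sup_{1 ≤ τ ≤ m} E[(θ - γ) τ] ≥ 0}` of an arm with posterior mean `ν`
and posterior variance `v` when `m ≥ 1` rounds remain. -/
def gittinsIndex (ν : ℝ) (v : ℝ≥0) (m : ℕ) : ℝ :=
  sSup {γ : ℝ | 0 ≤ stoppingValue ν v m γ}

/-! ### The bandit problem -/

/-- A history of length `t`: the arms chosen and the rewards received in the first `t` rounds. -/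
abbrev History (d t : ℕ) : Type := Fin t → Fin d × ℝ

/-- A (possibly randomised) strategy for a `d`-armed bandit: for each `t`, the law of the arm chosen
in round `t + 1`, given the history of the first `t` rounds. -/
structure Strategy (d : ℕ) where
  act : (t : ℕ) → Kernel (History d t) (Fin d)
  isMarkovKernel : ∀ t, IsMarkovKernel (act t)

attribute [instance] Strategy.isMarkovKernel

/-- Choosing arm `i` yields a reward with law `N(μ i, 1)`. -/
def rewardKernel {d : ℕ} (μ : Fin d → ℝ) : Kernel (Fin d) ℝ :=
  Kernel.ofFunOfCountable fun i => gaussianReal (μ i) 1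

instance {d : ℕ} (μ : Fin d → ℝ) : IsMarkovKernel (rewardKernel μ) :=
  ⟨fun i => inferInstanceAs (IsProbabilityMeasure (gaussianReal (μ i) 1))⟩

/-- The law of the history of the first `t` rounds, when the strategy `π` is used in the bandit with
mean vector `μ`. In each round an arm is drawn from the strategy given the past, then a reward is
drawn given the arm, and both are appended to the history. -/
def historyLaw {d : ℕ} (π : Strategy d) (μ : Fin d → ℝ) : (t : ℕ) → Measure (History d t)
  | 0 => Measure.dirac Fin.elim0
  | t + 1 =>
      ((historyLaw π μ t) ⊗ₘ
        ((π.act t) ⊗ₖ (Kernel.prodMkLeft (History d t) (rewardKernel μ)))).map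
        fun p => (Fin.snoc p.1 p.2 : History d (t + 1))

lemma measurable_snoc (d t : ℕ) :
    Measurable fun p : History d t × (Fin d × ℝ) => (Fin.snoc p.1 p.2 : History d (t + 1)) := by
  refine measurable_pi_lambda _ fun s => ?_
  refine Fin.lastCases ?_ (fun s => ?_) s
  · simpa using measurable_snd
  · have h : Measurable fun p : History d t × (Fin d × ℝ) => p.1 s :=
      (measurable_pi_apply s).comp measurable_fst
    simpa using h

instance isProbabilityMeasure_historyLaw {d : ℕ} (π : Strategy d) (μ : Fin d → ℝ) :
    (t : ℕ) → IsProbabilityMeasure (historyLaw π μ t)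
  | 0 => inferInstanceAs (IsProbabilityMeasure (Measure.dirac _))
  | t + 1 => by
    have := isProbabilityMeasure_historyLaw π μ t
    exact Measure.isProbabilityMeasure_map (measurable_snoc d t).aemeasurable

/-- The gap `Δ_i = max_j μ_j - μ_i`. -/
def gap {d : ℕ} (μ : Fin d → ℝ) (i : Fin d) : ℝ := (⨆ j, μ j) - μ i

/-- The expected regret of `π` up to horizon `n` in the bandit with mean vector `μ`. -/
def regret {d : ℕ} (π : Strategy d) (μ : Fin d → ℝ) (n : ℕ) : ℝ :=
  ∫ h, ∑ t, gap μ (h t).1 ∂(historyLaw π μ n)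

/-! ### The Gittins index strategy for a Gaussian prior -/

/-- The number of times that arm `i` was chosen. -/
def pulls {d t : ℕ} (h : History d t) (i : Fin d) : ℕ :=
  ∑ s, if (h s).1 = i then 1 else 0

/-- The sum of the rewards received from arm `i`. -/
def rewardSum {d t : ℕ} (h : History d t) (i : Fin d) : ℝ :=
  ∑ s, if (h s).1 = i then (h s).2 else 0

/-- The posterior mean of arm `i` for the prior `N(ν i, v i)`. -/
def posteriorMean {d t : ℕ} (ν : Fin d → ℝ) (v : Fin d → ℝ≥0) (h : History d t) (i : Fin d) : ℝ :=
  (ν i / v i + rewardSum h i) / (1 / v i + pulls h i)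

/-- The posterior variance of arm `i` for the prior `N(ν i, v i)`. -/
def posteriorVar {d t : ℕ} (v : Fin d → ℝ≥0) (h : History d t) (i : Fin d) : ℝ≥0 :=
  (1 / v i + pulls h i)⁻¹

/-- The Gittins index of arm `i` after the history `h` of `t < n` rounds at horizon `n`, when there
are `n - t` rounds remaining. -/
def armIndex {d t : ℕ} (ν : Fin d → ℝ) (v : Fin d → ℝ≥0) (n : ℕ) (h : History d t) (i : Fin d) : ℝ :=
  gittinsIndex (posteriorMean ν v h i) (posteriorVar v h i) (n - t)

/-- `π` is a Gittins index strategy with horizon `n` for the prior with independent components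
`N(ν i, v i)`: in each of the rounds `1, …, n` it chooses an arm of maximal index. Ties may be broken
in any way, possibly at random. -/
def IsGittinsStrategy {d : ℕ} (ν : Fin d → ℝ) (v : Fin d → ℝ≥0) (n : ℕ) (π : Strategy d) : Prop :=
  ∀ t < n, ∀ h : History d t, ∀ᵐ i ∂(π.act t h), ∀ j, armIndex ν v n h j ≤ armIndex ν v n h i

end GaussianBandit

end

open scoped ENNReal

namespace GaussianBandit

/-! ### Bounds on the Gittins index -/

section Index

variable {ν : ℝ} {v : ℝ≥0} {m : ℕ}

/-! The index behaves like an upper confidence bound whose confidence level depends on the number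
`m` of remaining rounds. With posterior mean `ν` and variance `v` it is at most `ν + √v x` once `m ≤
exp (x² / 2)` (`gittinsIndex_le`). It is at least `ν + √v x` once `m` exceeds `exp (x² / 2)` times
`1 + 1 / v` and a polynomial in `x` (`le_gittinsIndex_of_le`).

Let arm `i` have gap `Δ > 0` and let `k` be an optimal arm. A round that pulls `i` is of one of two
kinds. Either the index of `i` is at least `μ k - Δ / 2`, or the index of `k` is below this level.
In the first case, after about `32 log n / Δ²` pulls of `i` the confidence width is at most `Δ / 4`,
so the empirical mean of `i` must be off by `Δ / 8`. This has summable probability over the number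
of pulls.

In the second case the lower bound says that few rounds remain: if the posterior mean of `k` falls
short of the level by `x` standard deviations, then at most about `exp (x² / 2)` rounds are left. So
this state costs at most that many rounds. The growth `exp (x² / 2)` is cancelled by the Gaussian
density of the sum of `s` rewards of `k`. Since the level lies strictly below `μ k`, a factor
exponentially small in `s` is left (`failureBound_mul_gaussianPDF_le`), and the total expected cost
is bounded in `n`.

Both counts are organised by the number `s` of pulls of the arm. The supermartingale estimate
`sum_cost_le_of_potential` replaces the adaptively sampled sum of rewards by a sum of `s`
independent ones, whatever the strategy. -/

lemma measurable_armMap (m : ℕ) :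
    Measurable fun p : ℝ × (Fin m → ℝ) => (p.1, fun s => p.1 + p.2 s) := by
  fun_prop

instance isProbabilityMeasure_armLaw (ν : ℝ) (v : ℝ≥0) (m : ℕ) :
    IsProbabilityMeasure (armLaw ν v m) :=
  Measure.isProbabilityMeasure_map (measurable_armMap m).aemeasurable

lemma armLaw_map_fst (ν : ℝ) (v : ℝ≥0) (m : ℕ) :
    (armLaw ν v m).map Prod.fst = gaussianReal ν v := by
  rw [armLaw, Measure.map_map measurable_fst (measurable_armMap m)]
  exact (measurePreserving_fst (μ := gaussianReal ν v)
    (ν := Measure.pi fun _ : Fin m => gaussianReal 0 1)).map_eq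

lemma integral_armLaw_fst (f : ℝ → ℝ) (hf : Measurable f) :
    ∫ p, f p.1 ∂(armLaw ν v m) = ∫ x, f x ∂(gaussianReal ν v) := by
  rw [← armLaw_map_fst ν v m, integral_map measurable_fst.aemeasurable
    hf.aestronglyMeasurable]

lemma integrable_armLaw_fst {f : ℝ → ℝ} (hf : Integrable f (gaussianReal ν v)) :
    Integrable (fun p => f p.1) (armLaw ν v m) := by
  rw [← armLaw_map_fst ν v m] at hf
  exact hf.comp_measurable measurable_fst

lemma integrable_id_gaussianReal : Integrable (fun x => x) (gaussianReal ν v) :=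
  memLp_one_iff_integrable.1 (memLp_id_gaussianReal 1)

lemma integrable_sub_gaussianReal (γ : ℝ) : Integrable (fun x => x - γ) (gaussianReal ν v) :=
  integrable_id_gaussianReal.sub (integrable_const γ)

lemma integral_sub_gaussianReal (γ : ℝ) : ∫ x, (x - γ) ∂(gaussianReal ν v) = ν - γ := by
  rw [integral_sub integrable_id_gaussianReal (integrable_const γ), integral_id_gaussianReal]
  simp

lemma IsAdmissible.measurable {τ : ℝ × (Fin m → ℝ) → ℕ} (hτ : IsAdmissible m τ) :
    Measurable τ := by
  refine measurable_of_Iic fun i => ?_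
  have h := (rewardFiltration m).le i _ (hτ.isStoppingTime i)
  simpa [Set.Iic, Set.preimage] using h

lemma integrable_stopped {τ : ℝ × (Fin m → ℝ) → ℕ} (hτ : IsAdmissible m τ) (γ : ℝ) :
    Integrable (fun p => (p.1 - γ) * (τ p : ℝ)) (armLaw ν v m) := by
  refine (integrable_armLaw_fst (integrable_sub_gaussianReal γ)).mul_bdd (c := m) ?_ ?_
  · exact (measurable_from_top.comp hτ.measurable).aestronglyMeasurable
  · exact .of_forall fun p => by simpa using hτ.le p

lemma isAdmissible_one (hm : 1 ≤ m) : IsAdmissible m fun _ => 1 :=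
  ⟨isStoppingTime_const _ 1, fun _ => le_rfl, fun _ => hm⟩

/-- Stopping later than at time `1` gains at most `(m - 1) E(θ - γ)⁺`. -/
lemma integral_stopped_le {τ : ℝ × (Fin m → ℝ) → ℕ} (hτ : IsAdmissible m τ) (γ : ℝ) :
    ∫ p, (p.1 - γ) * (τ p : ℝ) ∂(armLaw ν v m) ≤
      (ν - γ) + (m - 1) * ∫ x, max (x - γ) 0 ∂(gaussianReal ν v) := by
  have hi : Integrable (fun x => max (x - γ) 0) (gaussianReal ν v) :=
    (integrable_sub_gaussianReal γ).pos_part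
  rw [← integral_sub_gaussianReal (ν := ν) (v := v) γ, ← integral_const_mul,
    ← integral_add (integrable_sub_gaussianReal γ) (hi.const_mul _),
    ← integral_armLaw_fst (m := m) (fun x => (x - γ) + (m - 1) * max (x - γ) 0) (by fun_prop)]
  refine integral_mono (integrable_stopped hτ γ)
    (integrable_armLaw_fst ((integrable_sub_gaussianReal γ).add (hi.const_mul _))) fun p => ?_
  have h1 : (1 : ℝ) ≤ τ p := by exact_mod_cast hτ.one_le p
  have h2 : (τ p : ℝ) ≤ m := by exact_mod_cast hτ.le p
  have h3 := le_max_left (p.1 - γ) 0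
  have h4 := le_max_right (p.1 - γ) 0
  dsimp only
  nlinarith [mul_nonneg (sub_nonneg.2 h1) (sub_nonneg.2 h3), mul_nonneg (sub_nonneg.2 h2) h4]

/-- Without boundedness the real supremum in `stoppingValue` would take the default value `0`. -/
lemma bddAbove_stopped (ν : ℝ) (v : ℝ≥0) (m : ℕ) (γ : ℝ) :
    BddAbove (Set.range fun τ : {τ : ℝ × (Fin m → ℝ) → ℕ // IsAdmissible m τ} =>
      ∫ p, (p.1 - γ) * (τ.1 p : ℝ) ∂(armLaw ν v m)) := by
  refine ⟨(ν - γ) + (m - 1) * ∫ x, max (x - γ) 0 ∂(gaussianReal ν v), ?_⟩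
  rintro _ ⟨τ, rfl⟩
  exact integral_stopped_le τ.2 γ

lemma le_stoppingValue {τ : ℝ × (Fin m → ℝ) → ℕ} (hτ : IsAdmissible m τ) (γ : ℝ) :
    ∫ p, (p.1 - γ) * (τ p : ℝ) ∂(armLaw ν v m) ≤ stoppingValue ν v m γ :=
  le_ciSup (bddAbove_stopped ν v m γ) ⟨τ, hτ⟩

lemma stoppingValue_le (hm : 1 ≤ m) (γ : ℝ) :
    stoppingValue ν v m γ ≤
      (ν - γ) + (m - 1) * ∫ x, max (x - γ) 0 ∂(gaussianReal ν v) := by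
  have : Nonempty {τ : ℝ × (Fin m → ℝ) → ℕ // IsAdmissible m τ} := ⟨⟨_, isAdmissible_one hm⟩⟩
  exact ciSup_le fun τ => integral_stopped_le τ.2 γ

/-- Chernoff's method: `λ y⁺ ≤ exp (λ y)`, and the Gaussian moment generating function is explicit.
-/
lemma integral_max_sub_le {lam : ℝ} (hl : 0 < lam) (γ : ℝ) :
    ∫ x, max (x - γ) 0 ∂(gaussianReal ν v) ≤
      Real.exp (lam * (ν - γ) + v * lam ^ 2 / 2) / lam := by
  have h1 : Integrable (fun x => Real.exp (-(lam * γ)) / lam * Real.exp (lam * x))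
      (gaussianReal ν v) := (integrable_exp_mul_gaussianReal lam).const_mul _
  have h2 : ∫ x, Real.exp (lam * x) ∂(gaussianReal ν v) =
      Real.exp (ν * lam + v * lam ^ 2 / 2) :=
    congrFun (mgf_fun_id_gaussianReal (μ := ν) (v := v)) lam
  calc _ ≤ ∫ x, Real.exp (-(lam * γ)) / lam * Real.exp (lam * x) ∂(gaussianReal ν v) := by
        refine integral_mono (integrable_sub_gaussianReal γ).pos_part h1 fun x => ?_
        have : Real.exp (-(lam * γ)) / lam * Real.exp (lam * x) =
            Real.exp (lam * (x - γ)) / lam := by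
          rw [div_mul_eq_mul_div, ← Real.exp_add]; ring_nf
        dsimp only
        rw [this, le_div_iff₀ hl]
        have h := Real.add_one_le_exp (lam * (x - γ))
        have h' := Real.exp_pos (lam * (x - γ))
        rcases max_cases (x - γ) 0 with ⟨e, -⟩ | ⟨e, -⟩ <;> rw [e] <;> nlinarith
    _ = _ := by
        rw [integral_const_mul, h2, div_mul_eq_mul_div, ← Real.exp_add]; ring_nf

/-- Write `γ = ν + √v y` with `y > x`. The choice `λ = y / √v` bounds the mean excess over `γ` by
`(√v / y) exp (-y² / 2)`. Gained at most `m - 1` times, this cannot repay the certain loss `√v y` of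
the first round. -/
lemma stoppingValue_neg (hv : 0 < v) (hm : 1 ≤ m) {x γ : ℝ} (hx : 1 ≤ x)
    (hmx : (m : ℝ) ≤ Real.exp (x ^ 2 / 2)) (hγ : ν + √v * x < γ) :
    stoppingValue ν v m γ < 0 := by
  have hs : 0 < √(v : ℝ) := Real.sqrt_pos.2 (by exact_mod_cast hv)
  have hsq : √(v : ℝ) ^ 2 = v := Real.sq_sqrt v.2
  set s := √(v : ℝ)
  obtain ⟨y, hy⟩ : ∃ y, γ = ν + s * y := ⟨(γ - ν) / s, by field_simp; ring⟩
  have hxy : x < y := by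
    rw [hy] at hγ
    exact lt_of_mul_lt_mul_left (by linarith) hs.le
  have hm1 : (1 : ℝ) ≤ m := by exact_mod_cast hm
  have h := (stoppingValue_le (ν := ν) (v := v) hm γ).trans
    (add_le_add_right (mul_le_mul_of_nonneg_left (integral_max_sub_le (lam := y / s)
      (by have : 0 < y := by linarith
          positivity) γ) (by linarith)) _)
  refine h.trans_lt ?_
  have e : y / s * (ν - γ) + v * (y / s) ^ 2 / 2 = -(y ^ 2 / 2) := by
    rw [hy, ← hsq]; field_simp; ring
  rw [e, hy]
  have h1 : (m : ℝ) * Real.exp (-(y ^ 2 / 2)) ≤ 1 := by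
    rw [Real.exp_neg, ← div_eq_mul_inv, div_le_one (Real.exp_pos _)]
    refine hmx.trans (Real.exp_le_exp.2 ?_)
    nlinarith
  have hE := Real.exp_pos (-(y ^ 2 / 2))
  have hy0 : 0 < y := by linarith
  have e2 : ν - (ν + s * y) + (m - 1) * (Real.exp (-(y ^ 2 / 2)) / (y / s)) =
      (s / y) * ((m - 1) * Real.exp (-(y ^ 2 / 2)) - y ^ 2) := by
    field_simp; ring
  rw [e2]
  refine mul_neg_of_pos_of_neg (by positivity) ?_
  nlinarith

lemma stoppingValue_self_nonneg (hm : 1 ≤ m) : 0 ≤ stoppingValue ν v m ν := by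
  refine le_trans (le_of_eq ?_) (le_stoppingValue (isAdmissible_one hm) ν)
  simp only [Nat.cast_one, mul_one]
  rw [integral_armLaw_fst (fun x => x - ν) (by fun_prop), integral_sub_gaussianReal, sub_self]

lemma bddAbove_gittinsSet (hv : 0 < v) (hm : 1 ≤ m) :
    BddAbove {γ : ℝ | 0 ≤ stoppingValue ν v m γ} := by
  refine ⟨ν + √v * max 1 (m : ℝ), fun γ hγ => le_of_not_gt fun h => ?_⟩
  refine absurd hγ (not_le.2 (stoppingValue_neg hv hm (le_max_left _ _) ?_ h))
  have h1 := le_max_left (1 : ℝ) m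
  have h2 := le_max_right (1 : ℝ) m
  have h3 := Real.add_one_le_exp (max 1 (m : ℝ) ^ 2 / 2)
  nlinarith [sq_nonneg (max 1 (m : ℝ) - 1)]

lemma gittinsIndex_le (hv : 0 < v) (hm : 1 ≤ m) {x : ℝ} (hx : 1 ≤ x)
    (hmx : (m : ℝ) ≤ Real.exp (x ^ 2 / 2)) : gittinsIndex ν v m ≤ ν + √v * x :=
  csSup_le ⟨ν, stoppingValue_self_nonneg hm⟩ fun _ hγ => le_of_not_gt fun h =>
    absurd hγ (not_le.2 (stoppingValue_neg hv hm hx hmx h))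

lemma le_gittinsIndex (hv : 0 < v) (hm : 1 ≤ m) {γ : ℝ} (h : 0 ≤ stoppingValue ν v m γ) :
    γ ≤ gittinsIndex ν v m :=
  le_csSup (bddAbove_gittinsSet hv hm) h

end Index

/-! ### Gaussian estimates: mean excess, posterior means, sums -/

section GaussianCalculations

/-- A lower bound for the mean excess of a centred Gaussian over the level `s * x`. -/
lemma le_integral_max_gaussianReal {w : ℝ≥0} {s x : ℝ} (hs : 0 < s) (hw : (w : ℝ) = s ^ 2)
    (hx : 1 ≤ x) :
    s * Real.exp (-(x ^ 2 / 2) - 4) / (3 * x ^ 2) ≤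
      ∫ u, max (u - s * x) 0 ∂(gaussianReal 0 w) := by
  have hx0 : 0 < x := by linarith
  have hw0 : w ≠ 0 := by
    rintro rfl
    have : 0 < s ^ 2 := by positivity
    simp at hw; linarith [hw.symm]
  -- On `[a, b]`, of length `s / x`, the excess is at least `s / x`, while the density has lost at
  -- most a factor `exp (-4)` against its value at `s * x`.
  set a := s * (x + 1 / x) with ha
  set b := s * (x + 2 / x) with hb
  have hab : b - a = s / x := by rw [ha, hb]; field_simp; ring
  have hab' : a ≤ b := by have : 0 < s / x := by positivity
                          linarith
  have hsx : 0 < s / x := by positivity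
  have ha0 : 0 ≤ a := by positivity
  set D := (√(2 * Real.pi * w))⁻¹ * Real.exp (-b ^ 2 / (2 * w)) with hD
  have hint : Integrable (fun u => max (u - s * x) 0) (gaussianReal 0 w) :=
    (integrable_sub_gaussianReal _).pos_part
  have hpdf : ∀ u ∈ Set.Icc a b, D ≤ gaussianPDFReal 0 w u := by
    intro u hu
    rw [gaussianPDFReal, hD]
    gcongr 2
    have : u ^ 2 ≤ b ^ 2 := pow_le_pow_left₀ (ha0.trans hu.1) hu.2 2
    simp only [sub_zero]
    gcongr
  have hprob : D * (s / x) ≤ (gaussianReal 0 w).real (Set.Icc a b) := by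
    rw [measureReal_def, gaussianReal_apply_eq_integral 0 hw0, ENNReal.toReal_ofReal
      (integral_nonneg fun u => gaussianPDFReal_nonneg _ _ _)]
    calc D * (s / x) = ∫ u in Set.Icc a b, D := by
          simp [hab, max_eq_left hsx.le, mul_comm]
      _ ≤ _ := setIntegral_mono_on (by simp)
          (integrable_gaussianPDFReal 0 w).integrableOn measurableSet_Icc hpdf
  have hmain : (s / x) * (gaussianReal 0 w).real (Set.Icc a b) ≤
      ∫ u, max (u - s * x) 0 ∂(gaussianReal 0 w) := by
    calc _ = ∫ u in Set.Icc a b, s / x ∂(gaussianReal 0 w) := by simp [mul_comm]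
      _ ≤ ∫ u in Set.Icc a b, max (u - s * x) 0 ∂(gaussianReal 0 w) := by
          refine setIntegral_mono_on (by simp) hint.integrableOn measurableSet_Icc fun u hu => ?_
          refine le_max_of_le_left ?_
          have : a = s * x + s / x := by rw [ha]; field_simp
          linarith [hu.1]
      _ ≤ _ := setIntegral_le_integral hint (.of_forall fun u => le_max_right _ _)
  refine le_trans ?_ ((mul_le_mul_of_nonneg_left hprob hsx.le).trans hmain)
  have hpi : √(2 * Real.pi * w) ≤ 3 * s := by
    refine Real.sqrt_le_iff.2 ⟨by positivity, ?_⟩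
    rw [hw]
    nlinarith [Real.pi_lt_four, sq_nonneg s]
  have hexp : Real.exp (-(x ^ 2 / 2) - 4) ≤ Real.exp (-b ^ 2 / (2 * w)) := by
    refine Real.exp_le_exp.2 ?_
    have e : -b ^ 2 / (2 * w) = -(x ^ 2 / 2) - 2 - 2 / x ^ 2 := by
      rw [hb, hw]; field_simp; ring
    have : 2 / x ^ 2 ≤ 2 := by rw [div_le_iff₀ (by positivity)]; nlinarith
    linarith
  have hpos : 0 < √(2 * Real.pi * w) := by
    have : 0 < (w : ℝ) := by rw [hw]; positivity
    have := Real.pi_pos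
    positivity
  calc s * Real.exp (-(x ^ 2 / 2) - 4) / (3 * x ^ 2)
      = s / x * ((3 * s)⁻¹ * Real.exp (-(x ^ 2 / 2) - 4) * (s / x)) := by field_simp
    _ ≤ _ := by
      rw [hD]
      gcongr

variable {Ω : Type*} [MeasurableSpace Ω] {P : Measure Ω}

/-- If `θ ∼ N(ν, v)` and the independent noise `N` has law `N(0, u)`, then observing `θ + N` and
collecting `θ - γ` when the posterior mean exceeds `γ` yields the mean excess of the posterior mean,
whose variance is `v ^ 2 / (v + u)`. -/
lemma integral_indicator_posterior {θ N : Ω → ℝ} {ν : ℝ} {v u : ℝ≥0}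
    (hv : 0 < v) (hθ : HasLaw θ (gaussianReal ν v) P) (hN : HasLaw N (gaussianReal 0 u) P)
    (hθN : IndepFun θ N P) (a : ℝ) {w : ℝ≥0} (hw : w = v ^ 2 / (v + u)) :
    ∫ ω, Set.indicator {ω | a ≤ v / (v + u) * (θ ω + N ω - ν)} (fun ω => θ ω - (ν + a)) ω ∂P =
      ∫ y, max (y - a) 0 ∂(gaussianReal 0 w) := by
  have hP : IsProbabilityMeasure P := hθ.isProbabilityMeasure
  have hG : HasGaussianLaw (fun ω => (θ ω, N ω)) P :=
    hθN.hasGaussianLaw hθ.hasGaussianLaw hN.hasGaussianLaw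
  have hθ2 := hG.fst.memLp_two
  have hN2 := hG.snd.memLp_two
  set ρ : ℝ := v / (v + u) with hρ
  have hvu : (v : ℝ) + u ≠ 0 := by positivity
  set U : Ω → ℝ := fun ω => ρ * (θ ω + N ω - ν) with hU
  -- `U` is the posterior mean minus `ν`, and `R` is the residual: `θ = U + R + ρ ν`. The choice of
  -- `ρ` makes them uncorrelated, hence independent by joint Gaussianity. An event determined by `U`
  -- therefore collects nothing on average from the centred residual.
  set R : Ω → ℝ := fun ω => (1 - ρ) * θ ω + -ρ * N ω with hR
  have hVθ : Var[θ; P] = v := by rw [hθ.variance_eq]; exact variance_id_gaussianReal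
  have hVN : Var[N; P] = u := by rw [hN.variance_eq]; exact variance_id_gaussianReal
  have hEθ : P[θ] = ν := by rw [hθ.integral_eq]; exact integral_id_gaussianReal
  have hEN : P[N] = 0 := by rw [hN.integral_eq]; exact integral_id_gaussianReal
  have hcov : cov[θ, N; P] = 0 := hθN.covariance_eq_zero hθ2 hN2
  have hcov' : cov[N, θ; P] = 0 := by rw [covariance_comm, hcov]
  set W : Ω → ℝ := fun ω => ρ * θ ω + ρ * N ω with hW
  have hWR : HasGaussianLaw (fun ω => (W ω, R ω)) P :=
    hG.map_fun ((ρ • ContinuousLinearMap.fst ℝ ℝ ℝ + ρ • ContinuousLinearMap.snd ℝ ℝ ℝ).prod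
      ((1 - ρ) • ContinuousLinearMap.fst ℝ ℝ ℝ + (-ρ) • ContinuousLinearMap.snd ℝ ℝ ℝ))
  have hc : ∀ a b c d : ℝ, cov[fun ω => a * θ ω + b * N ω, fun ω => c * θ ω + d * N ω; P] =
      a * c * v + b * d * u := by
    intro a b c d
    have m1 : ∀ c : ℝ, MemLp (fun ω => c * θ ω) 2 P := fun c => hθ2.const_mul c
    have m2 : ∀ c : ℝ, MemLp (fun ω => c * N ω) 2 P := fun c => hN2.const_mul c
    change cov[(fun ω => a * θ ω) + fun ω => b * N ω, (fun ω => c * θ ω) + fun ω => d * N ω; P] = _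
    rw [covariance_add_left (m1 _) (m2 _) ((m1 _).add (m2 _)),
      covariance_add_right (m1 _) (m1 _) (m2 _), covariance_add_right (m2 _) (m1 _) (m2 _)]
    simp only [covariance_const_mul_left, covariance_const_mul_right, hcov, hcov',
      covariance_self hθ2.aemeasurable, covariance_self hN2.aemeasurable, hVθ, hVN]
    ring
  have hind : IndepFun W R P := by
    refine hWR.indepFun_of_covariance_eq_zero ?_
    rw [hc, hρ]; field_simp; ring
  have hUW : U = fun ω => W ω - ρ * ν := by ext ω; simp only [hU, hW]; ring
  have hindU : IndepFun U R P := by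
    rw [hUW]
    exact hind.comp (φ := fun x => x - ρ * ν) (ψ := id) (by fun_prop) measurable_id
  have hUlaw : HasLaw U (gaussianReal 0 w) P := by
    have hGW : HasGaussianLaw W P := hWR.fst
    have h1 : HasLaw W (gaussianReal (ρ * ν) w) P := by
      refine ⟨hGW.aemeasurable, ?_⟩
      rw [hGW.map_eq_gaussianReal]
      congr 1
      · rw [hW, integral_add (hG.fst.integrable.const_mul _) (hG.snd.integrable.const_mul _),
          integral_const_mul, integral_const_mul, hEθ, hEN]; ring
      · rw [← covariance_self hGW.aemeasurable, hc]
        apply NNReal.coe_injective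
        rw [Real.coe_toNNReal _ (by positivity), hw, hρ]
        push_cast
        field_simp
    have h2 := gaussianReal_sub_const h1 (ρ * ν)
    rw [sub_self] at h2
    rw [hUW]; exact h2
  have hUi : Integrable U P := by
    rw [hUW]; exact hWR.fst.integrable.sub (integrable_const _)
  have hRi : Integrable R P := hWR.snd.integrable
  have hER : ∫ ω, R ω ∂P = (1 - ρ) * ν := by
    rw [hR, integral_add (hG.fst.integrable.const_mul _) (hG.snd.integrable.const_mul _),
      integral_const_mul, integral_const_mul, hEθ, hEN]; ring
  set g : ℝ → ℝ := Set.indicator (Set.Ici a) 1 with hg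
  have hgm : Measurable g := measurable_one.indicator measurableSet_Ici
  have hgb : ∀ y, ‖g y‖ ≤ 1 := fun y => by
    by_cases hy : y ∈ Set.Ici a <;> simp [hg, hy]
  have hgU : AEStronglyMeasurable (fun ω => g (U ω)) P :=
    (hgm.comp_aemeasurable hUi.aemeasurable).aestronglyMeasurable
  have hprod : ∫ ω, g (U ω) * (R ω - (1 - ρ) * ν) ∂P = 0 := by
    have h := (hindU.comp (φ := g) (ψ := fun x => x - (1 - ρ) * ν) hgm
      (by fun_prop)).integral_fun_mul_eq_mul_integral hgU
      (hRi.sub (integrable_const ((1 - ρ) * ν))).aestronglyMeasurable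
    simp only [Function.comp_apply] at h
    rw [h, integral_sub hRi (integrable_const _), hER]
    simp
  have hi1 : Integrable (fun ω => max (U ω - a) 0) P := (hUi.sub (integrable_const a)).pos_part
  have hi2 : Integrable (fun ω => g (U ω) * (R ω - (1 - ρ) * ν)) P :=
    (hRi.sub (integrable_const _)).bdd_mul (c := 1) hgU (.of_forall fun ω => hgb _)
  calc _ = ∫ ω, (max (U ω - a) 0 + g (U ω) * (R ω - (1 - ρ) * ν)) ∂P := by
        congr 1
        ext ω
        have hθ' : θ ω = U ω + R ω + ρ * ν := by simp only [hU, hR]; ring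
        by_cases h : a ≤ U ω
        · rw [Set.indicator_of_mem (show ω ∈ {ω | a ≤ U ω} from h), hg,
            Set.indicator_of_mem (show U ω ∈ Set.Ici a from h), max_eq_left (by linarith), hθ']
          simp only [Pi.one_apply]; ring
        · rw [Set.indicator_of_notMem (show ω ∉ {ω | a ≤ U ω} from h), hg,
            Set.indicator_of_notMem (show U ω ∉ Set.Ici a from h),
            max_eq_right (by linarith [not_le.1 h])]
          ring
    _ = ∫ ω, max (U ω - a) 0 ∂P := by rw [integral_add hi1 hi2, hprod, add_zero]
    _ = _ := by
        rw [← hUlaw.map_eq, integral_map hUlaw.aemeasurable (by fun_prop)]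

lemma hasLaw_sum_gaussianReal {ι : Type*} [Fintype ι] (S : Finset ι) :
    HasLaw (fun ξ : ι → ℝ => ∑ i ∈ S, ξ i) (gaussianReal 0 S.card)
      (Measure.pi fun _ : ι => gaussianReal 0 1) := by
  classical
  set Q : Measure (ι → ℝ) := Measure.pi fun _ : ι => gaussianReal 0 1
  have hind : iIndepFun (fun i (ξ : ι → ℝ) => ξ i) Q :=
    iIndepFun_pi (X := fun _ x => x) fun _ => aemeasurable_id
  have hl : ∀ i, Q.map (fun ξ => ξ i) = gaussianReal 0 1 := fun i =>
    (measurePreserving_eval _ i).map_eq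
  refine ⟨by fun_prop, ?_⟩
  induction S using Finset.induction_on with
  | empty => simp [gaussianReal_zero_var]
  | insert i S hi ih =>
    have h1 : IndepFun (fun ξ : ι → ℝ => ξ i) (fun ξ => ∑ j ∈ S, ξ j) Q := by
      have := hind.indepFun_finsetSum_of_notMem (fun i => measurable_pi_apply i) hi
      convert this.symm using 1
      ext ξ; simp
    have h2 := gaussianReal_add_gaussianReal_of_indepFun h1 (hl i) ih
    rw [Finset.card_insert_of_notMem hi]
    simp only [Finset.sum_insert hi]
    convert h2 using 2
    · ext ξ; rfl
    · exact (add_zero (0 : ℝ)).symm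
    · rw [Nat.cast_succ, add_comm]

end GaussianCalculations

/-! ### Lower bound on the index -/

section IndexLower

variable {ν : ℝ} {v : ℝ≥0} {m : ℕ}

lemma measurable_coord_rewardFiltration {s : Fin m} {t : ℕ} (hst : (s : ℕ) < t) :
    Measurable[rewardFiltration m t] fun p : ℝ × (Fin m → ℝ) => p.2 s :=
  (comap_measurable _).mono
    (le_iSup₂ (f := fun (s : Fin m) (_ : (s : ℕ) < t) =>
      MeasurableSpace.comap (fun p : ℝ × (Fin m → ℝ) => p.2 s) inferInstance) s hst) le_rfl

/-- Continue to time `m` if an event `A` known at time `k` occurs, and stop at time `k` otherwise. -/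
lemma isAdmissible_ite {k : ℕ} (hk : 1 ≤ k) (hkm : k ≤ m) {A : Set (ℝ × (Fin m → ℝ))}
    [DecidablePred (· ∈ A)] (hA : MeasurableSet[rewardFiltration m k] A) :
    IsAdmissible m fun p => if p ∈ A then m else k where
  isStoppingTime := by
    intro t
    by_cases hmt : m ≤ t
    · convert MeasurableSet.univ using 1
      ext p
      simp only [Set.mem_ofPred_eq, Set.mem_univ, iff_true]
      split_ifs
      · simpa using hmt
      · simpa using hkm.trans hmt
    by_cases hkt : k ≤ t
    · convert (rewardFiltration m).mono hkt _ hA.compl using 1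
      ext p
      by_cases hp : p ∈ A
      · simpa [hp] using hmt
      · simpa [hp] using hkt
    · convert MeasurableSet.empty using 1
      ext p
      by_cases hp : p ∈ A
      · simpa [hp] using hmt
      · simpa [hp] using hkt
  one_le p := by split_ifs <;> lia
  le p := by split_ifs <;> lia

/-- The case of `integral_indicator_posterior` where the noise is the average of `k` standard
Gaussians, of variance `1 / k`. -/
lemma integral_armLaw_indicator (hv : 0 < v) {k : ℕ} (hk : 1 ≤ k) (hkm : k ≤ m) (a : ℝ) {w : ℝ≥0}
    (hw : w = v ^ 2 / (v + (k : ℝ≥0)⁻¹)) :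
    ∫ p, Set.indicator
        {p | a ≤ v / (v + (k : ℝ≥0)⁻¹ : ℝ≥0) *
          ((∑ s ∈ Finset.univ.filter (fun s : Fin m => (s : ℕ) < k), p.2 s) / k - ν)}
        (fun p => p.1 - (ν + a)) p ∂(armLaw ν v m) =
      ∫ y, max (y - a) 0 ∂(gaussianReal 0 w) := by
  have hk0 : (k : ℝ) ≠ 0 := by positivity
  set S : Finset (Fin m) := Finset.univ.filter fun s => (s : ℕ) < k with hS
  have hcard : S.card = k := by
    rw [hS, Fin.card_filter_val_lt, min_eq_right hkm]
  set Q := (gaussianReal ν v).prod (Measure.pi fun _ : Fin m => gaussianReal 0 1) with hQ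
  have hθ : HasLaw (fun q : ℝ × (Fin m → ℝ) => q.1) (gaussianReal ν v) Q :=
    ⟨by fun_prop, (measurePreserving_fst (μ := gaussianReal ν v)
      (ν := Measure.pi fun _ : Fin m => gaussianReal 0 1)).map_eq⟩
  have hN0 : HasLaw (fun ξ : Fin m → ℝ => (∑ s ∈ S, ξ s) / k) (gaussianReal 0 (k : ℝ≥0)⁻¹)
      (Measure.pi fun _ : Fin m => gaussianReal 0 1) := by
    have h := gaussianReal_div_const (hasLaw_sum_gaussianReal S) (k : ℝ)
    convert h using 2
    · simp
    · apply NNReal.coe_injective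
      rw [hcard]
      push_cast
      field_simp
  have hN : HasLaw (fun q : ℝ × (Fin m → ℝ) => (∑ s ∈ S, q.2 s) / k)
      (gaussianReal 0 (k : ℝ≥0)⁻¹) Q := by
    refine ⟨by fun_prop, ?_⟩
    have h := (measurePreserving_snd (μ := gaussianReal ν v)
      (ν := Measure.pi fun _ : Fin m => gaussianReal 0 1)).map_eq
    rw [← hN0.map_eq, ← h, Measure.map_map (by fun_prop) measurable_snd]
    rfl
  have hind : IndepFun (fun q : ℝ × (Fin m → ℝ) => q.1)
      (fun q => (∑ s ∈ S, q.2 s) / k) Q :=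
    indepFun_prod (X := fun x : ℝ => x) (Y := fun ξ : Fin m → ℝ => (∑ s ∈ S, ξ s) / k)
      (by fun_prop) (by fun_prop)
  rw [← integral_indicator_posterior hv hθ hN hind a hw, armLaw, integral_map
    (measurable_armMap m).aemeasurable]
  · congr 1
    ext q
    have : (∑ s ∈ S, (q.1 + q.2 s)) / k = q.1 + (∑ s ∈ S, q.2 s) / k := by
      rw [Finset.sum_add_distrib, Finset.sum_const, hcard, nsmul_eq_mul]
      field_simp
    simp only [Set.indicator, Set.mem_ofPred_eq, this, NNReal.coe_add]
  · refine Measurable.aestronglyMeasurable (Measurable.indicator (by fun_prop) ?_)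
    exact measurableSet_le (by fun_prop) (by fun_prop)

/-- Test the stopping rule that samples `k` times and continues to `m` only if the posterior mean is
then at least `γ = ν + √v x`. Sampling costs `k √v x` on average; continuing gains `m - k` times the
mean excess of the posterior mean over `γ`. For `m` this large the gain pays for the sampling. -/
lemma le_gittinsIndex_of_le (hv : 0 < v) {x : ℝ} (hx : 1 ≤ x)
    (hm : 24 * Real.exp 5 * (1 + 1 / v) * x ^ 5 * Real.exp (x ^ 2 / 2) ≤ m) :
    ν + √v * x ≤ gittinsIndex ν v m := by
  have hv' : (0 : ℝ) < v := by exact_mod_cast hv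
  have hx0 : 0 < x := by linarith
  -- With `k v ≥ x²` the posterior mean has nearly the prior variance: in its own standard
  -- deviations the level is `x'` with `x'² ≤ x² + 1`, so the Gaussian tail loses only a constant
  -- factor.
  set k := ⌈x ^ 2 / (v : ℝ)⌉₊ with hkdef
  have hk : 1 ≤ k := Nat.one_le_ceil_iff.2 (by positivity)
  have hk1 : (1 : ℝ) ≤ k := by exact_mod_cast hk
  have hkv : x ^ 2 ≤ k * v := (div_le_iff₀ hv').1 (Nat.le_ceil _)
  have hkub : (k : ℝ) ≤ x ^ 2 * (1 + 1 / v) := by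
    have h1 := (Nat.ceil_lt_add_one (show 0 ≤ x ^ 2 / (v : ℝ) by positivity)).le
    have h2 : x ^ 2 * (1 + 1 / v) = x ^ 2 / v + x ^ 2 := by ring
    rw [h2]; nlinarith
  have hE5 : 1 ≤ Real.exp 5 := Real.one_le_exp (by norm_num)
  have hEx : 1 ≤ Real.exp (x ^ 2 / 2) := Real.one_le_exp (by positivity)
  have hm' : 24 * Real.exp 5 * x ^ 3 * Real.exp (x ^ 2 / 2) * k ≤ m := by
    refine le_trans ?_ hm
    calc _ ≤ 24 * Real.exp 5 * x ^ 3 * Real.exp (x ^ 2 / 2) * (x ^ 2 * (1 + 1 / v)) := by gcongr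
      _ = _ := by ring
  have h2k : 2 * (k : ℝ) ≤ m := by
    refine le_trans ?_ hm'
    have : 1 ≤ x ^ 3 := one_le_pow₀ hx
    have h3 : 1 * 1 * 1 ≤ Real.exp 5 * x ^ 3 * Real.exp (x ^ 2 / 2) := by gcongr
    nlinarith
  have hkm : k ≤ m := by
    have : (k : ℝ) ≤ m := by linarith
    exact_mod_cast this
  set s := √(v : ℝ) with hs
  have hspos : 0 < s := Real.sqrt_pos.2 hv'
  have hssq : s ^ 2 = v := Real.sq_sqrt v.2
  set w : ℝ≥0 := v ^ 2 / (v + (k : ℝ≥0)⁻¹) with hw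
  have hwr : (w : ℝ) = v ^ 2 / (v + (k : ℝ)⁻¹) := by rw [hw]; push_cast; rfl
  have hwpos : (0 : ℝ) < w := by rw [hwr]; positivity
  set s' := √(w : ℝ) with hs'
  have hs'pos : 0 < s' := Real.sqrt_pos.2 hwpos
  have hs'sq : s' ^ 2 = w := Real.sq_sqrt w.2
  set x' := s * x / s' with hx'
  have hsx : s' * x' = s * x := by rw [hx']; field_simp
  have hx'sq : x' ^ 2 = x ^ 2 + x ^ 2 / (k * v) := by
    rw [hx', div_pow, mul_pow, hs'sq, hssq, hwr]; field_simp
  have hr1 : x ^ 2 / (k * v) ≤ 1 := (div_le_one (by positivity)).2 hkv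
  have hr0 : 0 ≤ x ^ 2 / (k * v) := by positivity
  have hx'pos : 0 < x' := by positivity
  have hx'1 : x ≤ x' := le_of_sq_le_sq (by linarith) hx'pos.le
  have hs's : s / 2 ≤ s' := by
    have h1 : x' ≤ 2 * x := le_of_sq_le_sq (by nlinarith) (by positivity)
    have h2 : s' * x' ≤ s' * (2 * x) := by gcongr
    have h3 : s * x ≤ (2 * s') * x := by linarith
    have := le_of_mul_le_mul_right h3 hx0
    linarith
  set a := s * x with ha
  set A : Set (ℝ × (Fin m → ℝ)) :=
    {p | a ≤ v / (v + (k : ℝ≥0)⁻¹ : ℝ≥0) *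
          ((∑ s ∈ Finset.univ.filter (fun s : Fin m => (s : ℕ) < k), p.2 s) / k - ν)}
    with hA
  have hsum : Measurable[rewardFiltration m k] fun p : ℝ × (Fin m → ℝ) =>
      ∑ s ∈ Finset.univ.filter (fun s : Fin m => (s : ℕ) < k), p.2 s :=
    Finset.measurable_sum _ fun s hs =>
      measurable_coord_rewardFiltration (Finset.mem_filter.1 hs).2
  have hAm : MeasurableSet[rewardFiltration m k] A :=
    measurableSet_le measurable_const (((hsum.div_const _).sub_const _).const_mul _)
  have hAm' : MeasurableSet A := (rewardFiltration m).le k _ hAm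
  classical
  have hτ := isAdmissible_ite hk hkm hAm
  refine le_gittinsIndex hv (hk.trans hkm) (le_trans ?_ (le_stoppingValue hτ (ν + a)))
  have hi : Integrable (fun p : ℝ × (Fin m → ℝ) => p.1 - (ν + a)) (armLaw ν v m) :=
    integrable_armLaw_fst (integrable_sub_gaussianReal (ν + a))
  have hval : ∫ p, (p.1 - (ν + a)) * ((if p ∈ A then m else k : ℕ) : ℝ) ∂(armLaw ν v m) =
      k * (-a) + (m - k) * ∫ y, max (y - a) 0 ∂(gaussianReal 0 w) := by
    rw [← integral_armLaw_indicator (ν := ν) hv hk hkm a hw]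
    have e1 : ∫ p, (p.1 - (ν + a)) ∂(armLaw ν v m) = -a := by
      rw [integral_armLaw_fst (fun x => x - (ν + a)) (by fun_prop), integral_sub_gaussianReal]
      ring
    rw [← e1, ← integral_const_mul, ← integral_const_mul,
      ← integral_add (hi.const_mul _) ((hi.indicator hAm').const_mul _)]
    congr 1
    ext p
    by_cases hp : p ∈ A
    · simp only [hp, if_true, Set.indicator_of_mem]; ring
    · simp only [hp, if_false, Set.indicator_of_notMem, not_false_eq_true]; ring
  rw [hval]
  have hmax := le_integral_max_gaussianReal (w := w) hs'pos hs'sq.symm (hx.trans hx'1)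
  rw [hsx] at hmax
  have hE : s * Real.exp (-(x ^ 2 / 2) - 5) / (12 * x ^ 2) ≤
      ∫ y, max (y - a) 0 ∂(gaussianReal 0 w) := by
    refine le_trans ?_ hmax
    calc _ = (s / 2) * Real.exp (-(x ^ 2 / 2) - 5) / (3 * (2 * x ^ 2)) := by field_simp; norm_num
      _ ≤ _ := by
        have h1 : x' ^ 2 ≤ 2 * x ^ 2 := by nlinarith
        have h2 : Real.exp (-(x ^ 2 / 2) - 5) ≤ Real.exp (-(x' ^ 2 / 2) - 4) :=
          Real.exp_le_exp.2 (by linarith)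
        gcongr
  have hmk : (m : ℝ) / 2 ≤ m - k := by linarith
  have hpos : 0 ≤ s * Real.exp (-(x ^ 2 / 2) - 5) / (12 * x ^ 2) := by positivity
  have hfin : k * a ≤ m / 2 * (s * Real.exp (-(x ^ 2 / 2) - 5) / (12 * x ^ 2)) := by
    have e : Real.exp (-(x ^ 2 / 2) - 5) = (Real.exp (x ^ 2 / 2) * Real.exp 5)⁻¹ := by
      rw [← Real.exp_add, ← Real.exp_neg]; ring_nf
    calc k * a = (24 * Real.exp 5 * x ^ 3 * Real.exp (x ^ 2 / 2) * k) / 2 *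
          (s * (Real.exp (x ^ 2 / 2) * Real.exp 5)⁻¹ / (12 * x ^ 2)) := by
          rw [ha]; field_simp; norm_num
      _ ≤ _ := by rw [e]; gcongr
  have : (m : ℝ) / 2 * (s * Real.exp (-(x ^ 2 / 2) - 5) / (12 * x ^ 2)) ≤
      (m - k) * ∫ y, max (y - a) 0 ∂(gaussianReal 0 w) :=
    mul_le_mul hmk hE hpos (by linarith)
  linarith

/-- If the index is less than `ν + √v x`, then the number of remaining rounds is at most of order
`exp (x ^ 2 / 2)`, up to a factor of lower order. -/
lemma exists_le_of_gittinsIndex_lt {η : ℝ} (hη : 0 < η) :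
    ∃ K : ℝ, 0 < K ∧ ∀ (ν : ℝ) (v : ℝ≥0) (m : ℕ) (x : ℝ), 0 < v → 0 < x →
      gittinsIndex ν v m < ν + √v * x →
      (m : ℝ) ≤ K * (1 + 1 / v) * Real.exp (x ^ 2 / 2 + η * x) := by
  refine ⟨24 * Real.exp 5 * ((5 / η) ^ 5 * Real.exp η * Real.exp (1 / 2)), by positivity, ?_⟩
  intro ν v m x hv hx hlt
  -- The lower bound on the index needs an argument of at least `1`.
  set z := max 1 x with hz
  have hv' : (0 : ℝ) < v := by exact_mod_cast hv
  have hz1 : 1 ≤ z := le_max_left _ _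
  have hlt' : gittinsIndex ν v m < ν + √v * z := hlt.trans_le (by gcongr; exact le_max_right _ _)
  have hm : (m : ℝ) ≤ 24 * Real.exp 5 * (1 + 1 / v) * z ^ 5 * Real.exp (z ^ 2 / 2) :=
    le_of_not_ge fun h => absurd (le_gittinsIndex_of_le (ν := ν) hv hz1 h) (not_le.2 hlt')
  refine hm.trans ?_
  have hzx : z ≤ 1 + x := max_le (by linarith) (by linarith)
  have hzsq : z ^ 2 ≤ 1 + x ^ 2 := by
    rcases max_cases 1 x with ⟨h, -⟩ | ⟨h, -⟩ <;> rw [hz, h] <;> nlinarith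
  -- The polynomial factor is absorbed into `exp (η x)`, at the price of a constant depending on
  -- `η`.
  have hz5 : z ^ 5 ≤ (5 / η) ^ 5 * (Real.exp η * Real.exp (η * x)) := by
    have h1 : z ≤ 5 / η * Real.exp (η / 5 * (1 + x)) := by
      have h2 := Real.add_one_le_exp (η / 5 * (1 + x))
      calc z ≤ 5 / η * (η / 5 * (1 + x)) := by field_simp; exact hzx
        _ ≤ _ := by gcongr; linarith
    calc z ^ 5 ≤ (5 / η * Real.exp (η / 5 * (1 + x))) ^ 5 := by gcongr
      _ = _ := by
        rw [mul_pow, ← Real.exp_nat_mul, ← Real.exp_add]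
        congr 2; push_cast; ring
  have hzE : Real.exp (z ^ 2 / 2) ≤ Real.exp (1 / 2) * Real.exp (x ^ 2 / 2) := by
    rw [← Real.exp_add]; exact Real.exp_le_exp.2 (by linarith)
  calc 24 * Real.exp 5 * (1 + 1 / v) * z ^ 5 * Real.exp (z ^ 2 / 2)
      ≤ 24 * Real.exp 5 * (1 + 1 / v) * ((5 / η) ^ 5 * (Real.exp η * Real.exp (η * x))) *
        (Real.exp (1 / 2) * Real.exp (x ^ 2 / 2)) := by gcongr
    _ = _ := by rw [Real.exp_add]; ring

end IndexLower

/-! ### Expected costs along the history of a bandit -/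

section Bandit

variable {d : ℕ}

lemma measurable_pulls (t : ℕ) (i : Fin d) : Measurable fun h : History d t => pulls h i :=
  Finset.measurable_sum _ fun s _ =>
    (measurable_of_countable fun j : Fin d => if j = i then 1 else 0).comp
      (measurable_fst.comp (measurable_pi_apply s))

lemma measurable_rewardSum (t : ℕ) (i : Fin d) : Measurable fun h : History d t => rewardSum h i :=
  Finset.measurable_sum _ fun s _ =>
    Measurable.ite (measurableSet_eq_fun (measurable_fst.comp (measurable_pi_apply s))
      measurable_const) (measurable_snd.comp (measurable_pi_apply s)) measurable_const

lemma pulls_snoc {t : ℕ} (h : History d t) (j : Fin d) (x : ℝ) (i : Fin d) :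
    pulls (Fin.snoc h (j, x) : History d (t + 1)) i = pulls h i + if j = i then 1 else 0 := by
  simp only [pulls, Fin.sum_univ_castSucc, Fin.snoc_castSucc, Fin.snoc_last]

lemma rewardSum_snoc {t : ℕ} (h : History d t) (j : Fin d) (x : ℝ) (i : Fin d) :
    rewardSum (Fin.snoc h (j, x) : History d (t + 1)) i =
      rewardSum h i + if j = i then x else 0 := by
  simp [rewardSum, Fin.sum_univ_castSucc]

lemma lintegral_historyLaw_succ (π : Strategy d) (μ : Fin d → ℝ) (t : ℕ)
    {F : History d (t + 1) → ℝ≥0∞} (hF : Measurable F) :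
    ∫⁻ h, F h ∂(historyLaw π μ (t + 1)) =
      ∫⁻ h, ∫⁻ j, ∫⁻ x, F (Fin.snoc h (j, x)) ∂(gaussianReal (μ j) 1) ∂(π.act t h)
        ∂(historyLaw π μ t) := by
  have hG : Measurable fun p : History d t × (Fin d × ℝ) => F (Fin.snoc p.1 p.2) :=
    hF.comp (measurable_snoc d t)
  rw [historyLaw, lintegral_map hF (measurable_snoc d t), Measure.lintegral_compProd hG]
  refine lintegral_congr fun h => ?_
  exact Kernel.lintegral_compProd _ _ _ (hG.comp measurable_prodMk_left)

lemma lintegral_gaussianReal_add (m₁ m₂ : ℝ) (v₁ v₂ : ℝ≥0) {f : ℝ → ℝ≥0∞} (hf : Measurable f) :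
    ∫⁻ x, ∫⁻ y, f (x + y) ∂(gaussianReal m₂ v₂) ∂(gaussianReal m₁ v₁) =
      ∫⁻ z, f z ∂(gaussianReal (m₁ + m₂) (v₁ + v₂)) := by
  rw [← gaussianReal_conv_gaussianReal, Measure.lintegral_conv hf]

/-- The potential of a history with `T` pulls of an arm with mean `m` and sum of rewards `S`: the
expectation of `g` at the sum of the first `s` rewards, and zero if `s < T`. -/
noncomputable def levelPotential (m : ℝ) (s : ℕ) (g : ℝ → ℝ≥0∞) (T : ℕ) (S : ℝ) : ℝ≥0∞ :=
  if T ≤ s then ∫⁻ y, g (S + y) ∂(gaussianReal ((s - T : ℕ) * m) (s - T : ℕ)) else 0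

lemma measurable_levelPotential (m : ℝ) (s : ℕ) {g : ℝ → ℝ≥0∞} (hg : Measurable g) (T : ℕ) :
    Measurable (levelPotential m s g T) := by
  unfold levelPotential
  split_ifs
  · exact Measurable.lintegral_prod_right' (f := fun p : ℝ × ℝ => g (p.1 + p.2)) (by fun_prop)
  · exact measurable_const

lemma levelPotential_self (m : ℝ) (s : ℕ) (g : ℝ → ℝ≥0∞) (S : ℝ) :
    levelPotential m s g s S = g S := by
  simp [levelPotential, gaussianReal_zero_var]

lemma levelPotential_of_lt (m : ℝ) {s T : ℕ} (g : ℝ → ℝ≥0∞) (S : ℝ) (h : s < T) :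
    levelPotential m s g T S = 0 := if_neg (not_le.2 h)

lemma levelPotential_mono (m : ℝ) (s : ℕ) {g g' : ℝ → ℝ≥0∞} (h : ∀ y, g y ≤ g' y) (T : ℕ) (S : ℝ) :
    levelPotential m s g T S ≤ levelPotential m s g' T S := by
  unfold levelPotential
  split_ifs
  · exact lintegral_mono fun y => h _
  · exact le_rfl

/-- Below level `s` the potential is a martingale under pulls of the arm: one of the missing
Gaussian rewards is revealed. -/
lemma lintegral_levelPotential_succ (m : ℝ) {s T : ℕ} {g : ℝ → ℝ≥0∞} (hg : Measurable g) (S : ℝ)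
    (h : T < s) :
    ∫⁻ x, levelPotential m s g (T + 1) (S + x) ∂(gaussianReal m 1) = levelPotential m s g T S := by
  have e := lintegral_gaussianReal_add m ((s - (T + 1) : ℕ) * m) 1 ((s - (T + 1) : ℕ) : ℝ≥0)
    (hg.comp (measurable_const_add S))
  have h1 : s - T = (s - (T + 1)) + 1 := by lia
  simp only [levelPotential, if_pos h.le, if_pos (Nat.succ_le_of_lt h)]
  simp only [Function.comp_apply, ← add_assoc] at e ⊢
  rw [e, h1]
  congr 2
  · push_cast; ring
  · push_cast; ring

variable (π : Strategy d) (μ : Fin d → ℝ)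

/-- Let a cost be incurred in the rounds in which arm `i` has been pulled exactly `s` times so far,
namely `c₁ t S` if it is pulled and `c₀ t S` if it is not, where `S` is its sum of rewards. If `g`
dominates the costs that are still to come, then the expected total cost is at most the
expectation of `g 0` at the sum of `s` rewards. -/
lemma sum_cost_le_of_potential (i : Fin d) (s n : ℕ) (g c₀ c₁ : ℕ → ℝ → ℝ≥0∞)
    (hg : ∀ t, Measurable (g t)) (hc₀ : ∀ t, Measurable (c₀ t)) (hc₁ : ∀ t, Measurable (c₁ t))
    (h₀ : ∀ t < n, ∀ y, c₀ t y + g (t + 1) y ≤ g t y) (h₁ : ∀ t < n, ∀ y, c₁ t y ≤ g t y) :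
    ∑ t ∈ Finset.range n, ∫⁻ h, (if pulls h i = s then
        ∫⁻ j, (if j = i then c₁ t (rewardSum h i) else c₀ t (rewardSum h i)) ∂(π.act t h) else 0)
        ∂(historyLaw π μ t) ≤
      ∫⁻ y, g 0 y ∂(gaussianReal (s * μ i) s) := by
  set Φ : (t : ℕ) → History d t → ℝ≥0∞ := fun t h =>
    levelPotential (μ i) s (g t) (pulls h i) (rewardSum h i) with hΦ
  have hΦm : ∀ t, Measurable (Φ t) := by
    intro t
    have h1 : Measurable fun p : ℝ × ℕ => levelPotential (μ i) s (g t) p.2 p.1 :=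
      measurable_from_prod_countable_left fun T =>
        measurable_levelPotential _ s (hg t) T
    exact h1.comp ((measurable_rewardSum t i).prodMk (measurable_pulls t i))
  -- Cost plus next potential is at most the present potential, for every choice of arm. Away from
  -- level `s` no cost is due and the potential does not increase on average. At level `s` waiting
  -- is paid for by the drop from `g t` to `g (t + 1)`, and pulling by all of `g t`, since the
  -- potential vanishes past the level.
  have hstep : ∀ t < n, ∀ h : History d t,
      (if pulls h i = s then
        ∫⁻ j, (if j = i then c₁ t (rewardSum h i) else c₀ t (rewardSum h i)) ∂(π.act t h) else 0) +
      ∫⁻ j, ∫⁻ x, Φ (t + 1) (Fin.snoc h (j, x)) ∂(gaussianReal (μ j) 1) ∂(π.act t h) ≤ Φ t h := by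
    intro t ht h
    have hanti : ∀ y, g (t + 1) y ≤ g t y := fun y => le_trans le_add_self (h₀ t ht y)
    have key : ∀ j, (if pulls h i = s then
        (if j = i then c₁ t (rewardSum h i) else c₀ t (rewardSum h i)) else 0) +
        ∫⁻ x, Φ (t + 1) (Fin.snoc h (j, x)) ∂(gaussianReal (μ j) 1) ≤ Φ t h := by
      intro j
      simp only [hΦ, pulls_snoc, rewardSum_snoc]
      by_cases hj : j = i
      · subst hj
        simp only [if_true]
        rcases lt_trichotomy (pulls h j) s with hlt | heq | hgt
        · rw [if_neg hlt.ne, zero_add, lintegral_levelPotential_succ _ (hg _) _ hlt]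
          exact levelPotential_mono _ _ hanti _ _
        · rw [if_pos heq, heq, levelPotential_self]
          simp only [levelPotential_of_lt _ _ _ (Nat.lt_succ_self s), lintegral_zero, add_zero]
          exact h₁ t ht _
        · rw [if_neg hgt.ne']
          simp [levelPotential_of_lt _ _ _ (hgt.trans (Nat.lt_succ_self _))]
      · simp only [if_neg hj, add_zero, lintegral_const, measure_univ, mul_one]
        by_cases hs : pulls h i = s
        · rw [if_pos hs, hs, levelPotential_self, levelPotential_self]
          exact h₀ t ht _
        · rw [if_neg hs, zero_add]
          exact levelPotential_mono _ _ hanti _ _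
    calc _ = ∫⁻ j, ((if pulls h i = s then
        (if j = i then c₁ t (rewardSum h i) else c₀ t (rewardSum h i)) else 0) +
        ∫⁻ x, Φ (t + 1) (Fin.snoc h (j, x)) ∂(gaussianReal (μ j) 1)) ∂(π.act t h) := by
          rw [lintegral_add_left (measurable_of_countable _)]
          split_ifs <;> simp
      _ ≤ ∫⁻ _, Φ t h ∂(π.act t h) := lintegral_mono key
      _ = Φ t h := by simp
  have hmain : ∀ k ≤ n, ∑ t ∈ Finset.range k, ∫⁻ h, (if pulls h i = s then
        ∫⁻ j, (if j = i then c₁ t (rewardSum h i) else c₀ t (rewardSum h i)) ∂(π.act t h) else 0)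
        ∂(historyLaw π μ t) + ∫⁻ h, Φ k h ∂(historyLaw π μ k) ≤
      ∫⁻ y, g 0 y ∂(gaussianReal (s * μ i) s) := by
    intro k
    induction k with
    | zero =>
      intro _
      rw [historyLaw, lintegral_dirac' _ (hΦm 0)]
      simp [hΦ, levelPotential, pulls, rewardSum]
    | succ k ih =>
      intro hk
      refine le_trans ?_ (ih (by lia))
      rw [Finset.sum_range_succ, add_assoc, lintegral_historyLaw_succ π μ k (hΦm (k + 1)),
        ← lintegral_add_left]
      · gcongr with h
        exact hstep k (by lia) h
      · refine Measurable.ite (measurableSet_eq_fun (measurable_pulls k i) measurable_const) ?_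
          measurable_const
        have hlin : ∀ h : History d k,
            ∫⁻ j, (if j = i then c₁ k (rewardSum h i) else c₀ k (rewardSum h i)) ∂(π.act k h) =
              ∑ j, (if j = i then c₁ k (rewardSum h i) else c₀ k (rewardSum h i)) *
                π.act k h {j} := fun h => lintegral_fintype _
        simp only [hlin]
        refine Finset.measurable_sum _ fun j _ => Measurable.mul ?_
          (Kernel.measurable_coe _ (measurableSet_singleton j))
        split_ifs
        · exact (hc₁ k).comp (measurable_rewardSum k i)
        · exact (hc₀ k).comp (measurable_rewardSum k i)
  exact le_trans le_self_add (hmain n le_rfl)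

end Bandit

/-! ### Expected cost of underestimating the optimal arm -/

section Failure

lemma gaussianReal_tail_le (μ : ℝ) (s : ℕ) {a : ℝ} (ha : 0 ≤ a) :
    gaussianReal (s * μ) s {y | s * a ≤ y - s * μ} ≤
      ENNReal.ofReal (Real.exp (-(s * a ^ 2 / 2))) := by
  have h := measure_ge_le_exp_mul_mgf (μ := gaussianReal (s * μ) s) (X := id) (s * a + s * μ) ha
    (integrable_exp_mul_gaussianReal a)
  rw [mgf_id_gaussianReal] at h
  simp only [← Real.exp_add] at h
  rw [← ofReal_measureReal]
  refine ENNReal.ofReal_le_ofReal (le_trans (le_of_eq ?_) (h.trans (le_of_eq ?_)))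
  · congr 1
    ext y
    simp only [Set.mem_ofPred_eq, id]
    constructor <;> intro h <;> linarith
  · congr 1
    push_cast
    ring

lemma tsum_exp_neg_ne_top {b : ℝ} (hb : 0 < b) :
    ∑' s : ℕ, ENNReal.ofReal (Real.exp (-(s * b))) ≠ ⊤ := by
  refine Summable.tsum_ofReal_ne_top ?_
  have := Real.summable_exp_nat_mul_iff.2 (neg_lt_zero.2 hb)
  simpa using this

/-- The standardised distance by which the posterior mean falls short of the level `z`, after `s`
rewards with sum `y`, for a prior with mean `ν` and precision `w`. -/
noncomputable def shortfall (ν w z : ℝ) (s : ℕ) (y : ℝ) : ℝ := ((w + s) * z - w * ν - y) / √(w + s)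

/-- A bound for the number of rounds in which the index is less than the level `z`, after `s`
rewards with sum `y`. -/
noncomputable def failureBound (K η ν w z : ℝ) (s : ℕ) (y : ℝ) : ℝ≥0∞ :=
  if 0 < shortfall ν w z s y then
    ENNReal.ofReal (K * (1 + (w + s)) *
      Real.exp (shortfall ν w z s y ^ 2 / 2 + η * shortfall ν w z s y))
  else 0

lemma measurable_shortfall (ν w z : ℝ) (s : ℕ) : Measurable (shortfall ν w z s) := by
  unfold shortfall; fun_prop

lemma measurable_failureBound (K η ν w z : ℝ) (s : ℕ) : Measurable (failureBound K η ν w z s) := by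
  have := measurable_shortfall ν w z s
  unfold failureBound
  exact Measurable.ite (measurableSet_lt measurable_const this) (by fun_prop) measurable_const

lemma lintegral_exp_neg_abs_ne_top {b : ℝ} (hb : 0 < b) :
    ∫⁻ y : ℝ, ENNReal.ofReal (Real.exp (-(b * |y|))) ≠ ⊤ := by
  have h1 : Integrable (fun y : ℝ => (2 + 2 / b ^ 2) * (1 + y ^ 2)⁻¹) :=
    integrable_inv_one_add_sq.const_mul _
  have h2 : Integrable (fun y : ℝ => Real.exp (-(b * |y|))) := by
    refine h1.mono' (by fun_prop) (.of_forall fun y => ?_)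
    rw [Real.norm_eq_abs, Real.abs_exp, Real.exp_neg, ← div_eq_mul_inv, inv_le_comm₀
      (Real.exp_pos _) (by positivity), inv_div, div_le_iff₀ (by positivity)]
    have h3 := Real.quadratic_le_exp_of_nonneg (show 0 ≤ b * |y| by positivity)
    have h4 : 0 ≤ b * |y| := by positivity
    have h5 : (b * |y|) ^ 2 = b ^ 2 * y ^ 2 := by rw [mul_pow, sq_abs]
    have h6 : (1 + b ^ 2 * y ^ 2 / 2) * (2 + 2 / b ^ 2) ≤
        Real.exp (b * |y|) * (2 + 2 / b ^ 2) := by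
      gcongr; linarith
    refine le_trans ?_ h6
    have : (1 + b ^ 2 * y ^ 2 / 2) * (2 + 2 / b ^ 2) = 2 + 2 / b ^ 2 + b ^ 2 * y ^ 2 + y ^ 2 := by
      field_simp; ring
    rw [this]
    have : 0 ≤ 2 / b ^ 2 + b ^ 2 * y ^ 2 := by positivity
    linarith
  exact h2.lintegral_lt_top.ne

/-- Let `u = s (μ - ε) - y`. The density is at most `exp (-u² / (2 s) - ε u - s ε² / 2)`, and its
first term cancels the growth `exp (x² / 2)` of the bound, up to a constant due to the prior. The
rate `η = ε / 2` is below `ε`, so `-ε u` still leaves decay in `|u|`. -/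
lemma failureBound_mul_gaussianPDF_le {K ε ν w μ : ℝ} (hK : 0 ≤ K) (hε : 0 < ε) (hw : 0 < w) {s : ℕ}
    (hs : 1 ≤ s) (y : ℝ) :
    gaussianPDF (s * μ) s y * failureBound K (ε / 2) ν w (μ - ε) s y ≤
      ENNReal.ofReal (K * Real.exp ((w * (μ - ε - ν)) ^ 2 / (2 * w) + 3 * ε * |w * (μ - ε - ν)|)) *
      ENNReal.ofReal ((1 + (w + s)) * Real.exp (-(s * (ε ^ 2 / 2)))) *
      ENNReal.ofReal (Real.exp (-(ε / 2 * |s * (μ - ε) - y|))) := by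
  have hs1 : (1 : ℝ) ≤ s := by exact_mod_cast hs
  unfold failureBound
  split_ifs with hx
  swap
  · simp
  set x := shortfall ν w (μ - ε) s y with hxdef
  set u := s * (μ - ε) - y with hu
  set r := w * (μ - ε - ν) with hr
  have hp : 0 < w + s := by positivity
  have hp1 : 1 ≤ √(w + s) := Real.one_le_sqrt.2 (by linarith)
  have hxu : x * √(w + s) = u + r := by
    rw [hxdef, shortfall, div_mul_cancel₀ _ (by positivity), hu, hr]; ring
  have hur : 0 < u + r := by rw [← hxu]; positivity
  have hx1 : x ≤ u + r := by rw [← hxu]; nlinarith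
  -- The Cauchy–Schwarz inequality separates the data term `u` from the prior term `r`.
  have hx2 : x ^ 2 ≤ u ^ 2 / s + r ^ 2 / w := by
    have h1 : x ^ 2 = (u + r) ^ 2 / (s + w) := by
      rw [← hxu, mul_pow, Real.sq_sqrt hp.le, add_comm (s : ℝ)]; field_simp
    have h2 : u ^ 2 / s + r ^ 2 / w - (u + r) ^ 2 / (s + w) =
        (u * w - r * s) ^ 2 / (s * w * (s + w)) := by field_simp; ring
    have h3 : 0 ≤ (u * w - r * s) ^ 2 / (s * w * (s + w)) := by positivity
    linarith
  have hpdf : gaussianPDFReal (s * μ) s y ≤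
      Real.exp (-(u ^ 2 / (2 * s)) - u * ε - s * (ε ^ 2 / 2)) := by
    rw [gaussianPDFReal]
    have e : -(y - s * μ) ^ 2 / (2 * ((s : ℝ≥0) : ℝ)) =
        -(u ^ 2 / (2 * s)) - u * ε - s * (ε ^ 2 / 2) := by
      rw [hu]; push_cast; field_simp; ring
    rw [e]
    refine mul_le_of_le_one_left (Real.exp_pos _).le (inv_le_one_of_one_le₀ ?_)
    rw [Real.one_le_sqrt]
    push_cast
    nlinarith [Real.pi_gt_three]
  have hexp : -(u ^ 2 / (2 * s)) - u * ε - s * (ε ^ 2 / 2) + (x ^ 2 / 2 + ε / 2 * x) ≤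
      r ^ 2 / (2 * w) + 3 * ε * |r| + -(s * (ε ^ 2 / 2)) + -(ε / 2 * |u|) := by
    have h1 : u ^ 2 / (2 * s) = u ^ 2 / s / 2 := by field_simp
    have h2 : r ^ 2 / (2 * w) = r ^ 2 / w / 2 := by field_simp
    -- A positive shortfall means `u > -r`, so a negative `u` is bounded by the prior term; `3 ε
    -- |r|` covers that case.
    have h3 : -u ≤ |r| := by linarith [le_abs_self r]
    have h4 : r ≤ |r| := le_abs_self r
    have h5 : 0 ≤ |r| := abs_nonneg r
    have h6 : -u * ε + ε / 2 * x ≤ 3 * ε * |r| + -(ε / 2 * |u|) := by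
      have h7 : ε / 2 * x ≤ ε / 2 * (u + r) := by gcongr
      rcases abs_cases u with ⟨e, -⟩ | ⟨e, -⟩ <;> rw [e] <;> nlinarith
    rw [h1, h2]
    linarith
  rw [gaussianPDF, ← ENNReal.ofReal_mul (gaussianPDFReal_nonneg _ _ _),
    ← ENNReal.ofReal_mul (by positivity), ← ENNReal.ofReal_mul (by positivity)]
  refine ENNReal.ofReal_le_ofReal ?_
  calc _ ≤ Real.exp (-(u ^ 2 / (2 * s)) - u * ε - s * (ε ^ 2 / 2)) *
        (K * (1 + (w + s)) * Real.exp (x ^ 2 / 2 + ε / 2 * x)) := by gcongr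
    _ = K * (1 + (w + s)) * Real.exp (-(u ^ 2 / (2 * s)) - u * ε - s * (ε ^ 2 / 2) +
        (x ^ 2 / 2 + ε / 2 * x)) := by rw [Real.exp_add _ (x ^ 2 / 2 + ε / 2 * x)]; ring
    _ ≤ K * (1 + (w + s)) * Real.exp
        (r ^ 2 / (2 * w) + 3 * ε * |r| + -(s * (ε ^ 2 / 2)) + -(ε / 2 * |u|)) := by gcongr
    _ = _ := by rw [Real.exp_add, Real.exp_add]; ring

lemma tsum_lintegral_failureBound_ne_top {K ε ν w μ : ℝ} (hK : 0 ≤ K) (hε : 0 < ε) (hw : 0 < w) :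
    ∑' s : ℕ, ∫⁻ y, failureBound K (ε / 2) ν w (μ - ε) s y ∂(gaussianReal (s * μ) s) ≠ ⊤ := by
  -- The term `s = 0` is separate: its law is a Dirac mass and has no density.
  rw [tsum_eq_zero_add' ENNReal.summable]
  refine ENNReal.add_ne_top.2 ⟨?_, ?_⟩
  · simp only [Nat.cast_zero, gaussianReal_zero_var, lintegral_dirac]
    unfold failureBound
    split_ifs <;> simp
  set A := ENNReal.ofReal
    (K * Real.exp ((w * (μ - ε - ν)) ^ 2 / (2 * w) + 3 * ε * |w * (μ - ε - ν)|))
  set J := ∫⁻ y : ℝ, ENNReal.ofReal (Real.exp (-(ε / 2 * |y|))) with hJ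
  have hJtop : J ≠ ⊤ := lintegral_exp_neg_abs_ne_top (by positivity)
  set f : ℕ → ℝ := fun s => (1 + (w + s)) * Real.exp (-(s * (ε ^ 2 / 2))) with hf
  have hsum : ∑' s : ℕ, ENNReal.ofReal (f s) ≠ ⊤ := by
    refine Summable.tsum_ofReal_ne_top ?_
    have hq : ‖Real.exp (-(ε ^ 2 / 2))‖ < 1 := by
      rw [Real.norm_eq_abs, Real.abs_exp, Real.exp_lt_one_iff]
      have : 0 < ε ^ 2 / 2 := by positivity
      linarith
    have h0 := (summable_pow_mul_geometric_of_norm_lt_one 0 hq).mul_left (1 + w)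
    have h1 := summable_pow_mul_geometric_of_norm_lt_one 1 hq
    refine (h0.add h1).congr fun s => ?_
    rw [hf, ← Real.exp_nat_mul]
    ring_nf
  have hle : ∀ s : ℕ, ∫⁻ y, failureBound K (ε / 2) ν w (μ - ε) (s + 1) y
      ∂(gaussianReal ((s + 1 : ℕ) * μ) (s + 1 : ℕ)) ≤ A * J * ENNReal.ofReal (f (s + 1)) := by
    intro s
    have h0 : ((s + 1 : ℕ) : ℝ≥0) ≠ 0 := by positivity
    rw [gaussianReal_of_var_ne_zero _ h0, lintegral_withDensity_eq_lintegral_mul _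
      (measurable_gaussianPDF _ _) (measurable_failureBound _ _ _ _ _ _)]
    -- By reflection and translation the integral over `y` does not depend on `s`; only a polynomial
    -- times a geometric factor remains to be summed.
    have hJ' : J = ∫⁻ y : ℝ, ENNReal.ofReal
        (Real.exp (-(ε / 2 * |(s + 1 : ℕ) * (μ - ε) - y|))) :=
      (lintegral_sub_left_eq_self (fun y : ℝ => ENNReal.ofReal (Real.exp (-(ε / 2 * |y|)))) _).symm
    rw [mul_right_comm, hJ', ← lintegral_const_mul _ (by fun_prop)]
    exact lintegral_mono fun y => failureBound_mul_gaussianPDF_le hK hε hw (by lia) y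
  refine ne_top_of_le_ne_top ?_ (ENNReal.tsum_le_tsum hle)
  rw [ENNReal.tsum_mul_left]
  refine ENNReal.mul_ne_top (ENNReal.mul_ne_top ENNReal.ofReal_ne_top hJtop) ?_
  exact ne_top_of_le_ne_top hsum (ENNReal.tsum_comp_le_tsum_of_injective
    (add_left_injective 1) fun s => ENNReal.ofReal (f s))

end Failure

/-! ### The regret of the Gittins index strategy -/

section Regret

variable {d : ℕ}

lemma pulls_le {t : ℕ} (h : History d t) (i : Fin d) : pulls h i ≤ t := by
  calc pulls h i ≤ ∑ _s : Fin t, 1 := Finset.sum_le_sum fun s _ => by split_ifs <;> simp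
    _ = t := by simp

lemma lintegral_pulls (π : Strategy d) (μ : Fin d → ℝ) (i : Fin d) (n : ℕ) :
    ∫⁻ h, (pulls h i : ℝ≥0∞) ∂(historyLaw π μ n) =
      ∑ t ∈ Finset.range n, ∫⁻ h, π.act t h {i} ∂(historyLaw π μ t) := by
  have hm : ∀ t, Measurable fun h : History d t => (pulls h i : ℝ≥0∞) := fun t =>
    measurable_from_top.comp (measurable_pulls t i)
  induction n with
  | zero => simp [historyLaw, pulls]
  | succ n ih =>
    rw [Finset.sum_range_succ, ← ih, lintegral_historyLaw_succ π μ n (hm (n + 1)),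
      ← lintegral_add_left (hm n)]
    refine lintegral_congr fun h => ?_
    simp only [pulls_snoc, lintegral_const, measure_univ, mul_one, Nat.cast_add]
    rw [lintegral_add_left measurable_const]
    have : (fun j : Fin d => (((if j = i then 1 else 0 : ℕ)) : ℝ≥0∞)) =
        Set.indicator {i} 1 := by
      ext j; by_cases hj : j = i <;> simp [hj]
    rw [this, lintegral_indicator_one (measurableSet_singleton i)]
    simp

lemma regret_eq (π : Strategy d) (μ : Fin d → ℝ) (n : ℕ) :
    regret π μ n =
      ∑ i, gap μ i * (∫⁻ h, (pulls h i : ℝ≥0∞) ∂(historyLaw π μ n)).toReal := by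
  have hm : ∀ i, Measurable fun h : History d n => (pulls h i : ℝ) := fun i =>
    measurable_from_top.comp (measurable_pulls n i)
  have hint : ∀ i, Integrable (fun h : History d n => (pulls h i : ℝ)) (historyLaw π μ n) := by
    intro i
    refine (integrable_const (n : ℝ)).mono' (hm i).aestronglyMeasurable (.of_forall fun h => ?_)
    simpa using pulls_le h i
  have hreg : ∀ h : History d n, ∑ t, gap μ (h t).1 = ∑ i, gap μ i * (pulls h i : ℝ) := by
    intro h
    simp only [pulls, Nat.cast_sum, Finset.mul_sum]
    rw [Finset.sum_comm]
    simp
  rw [regret]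
  simp only [hreg]
  rw [integral_finsetSum _ fun i _ => (hint i).const_mul _]
  refine Finset.sum_congr rfl fun i _ => ?_
  rw [integral_const_mul, integral_eq_lintegral_of_nonneg_ae (.of_forall fun h => by positivity)
    (hm i).aestronglyMeasurable]
  simp

lemma gap_nonneg (μ : Fin d → ℝ) (i : Fin d) : 0 ≤ gap μ i :=
  sub_nonneg.2 (le_ciSup (Set.finite_range μ).bddAbove i)

lemma posteriorMean_eq (ν : Fin d → ℝ) (v : Fin d → ℝ≥0) {t : ℕ} (h : History d t) (i : Fin d) :
    posteriorMean ν v h i =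
      ((v i : ℝ)⁻¹ * ν i + rewardSum h i) / ((v i : ℝ)⁻¹ + pulls h i) := by
  rw [posteriorMean]; congr 1 <;> ring

lemma coe_posteriorVar (v : Fin d → ℝ≥0) {t : ℕ} (h : History d t) (i : Fin d) :
    (posteriorVar v h i : ℝ) = ((v i : ℝ)⁻¹ + pulls h i)⁻¹ := by
  rw [posteriorVar]; push_cast; rw [one_div]

lemma posteriorVar_pos {v : Fin d → ℝ≥0} (hv : ∀ i, 0 < v i) {t : ℕ} (h : History d t)
    (i : Fin d) : 0 < posteriorVar v h i := by
  have := hv i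
  rw [posteriorVar]; positivity

/-- A well explored arm whose index exceeds its mean by half of its gap has a sum of rewards far
above its expectation. -/
lemma mul_le_rewardSum_sub_of_le_armIndex {ν : Fin d → ℝ} {v : Fin d → ℝ≥0} (hv : ∀ i, 0 < v i)
    {n t : ℕ} (hn : 2 ≤ n) (ht : t < n) (h : History d t) (i : Fin d) {m D : ℝ} (hD : 0 < D)
    (hs : 32 * Real.log n / D ^ 2 + 8 * ((v i : ℝ)⁻¹ * |m - ν i|) / D ≤ pulls h i)
    (hidx : m + D / 2 ≤ armIndex ν v n h i) :
    pulls h i * (D / 8) ≤ rewardSum h i - pulls h i * m := by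
  set w := (v i : ℝ)⁻¹ with hw
  have hw0 : 0 < w := inv_pos.2 (by exact_mod_cast hv i)
  set s : ℝ := (pulls h i : ℝ) with hsdef
  have hn2 : (2 : ℝ) ≤ n := by exact_mod_cast hn
  have hlog : 1 / 2 ≤ Real.log n := by
    have := Real.log_le_log (by norm_num) hn2
    linarith [Real.log_two_gt_d9]
  -- Then `exp (x² / 2) = n` dominates the number of remaining rounds. The first part of `hs` makes
  -- the confidence width at most `D / 4`; the second makes the prior bias at most `pulls h i * (D /
  -- 8)`.
  set x := √(2 * Real.log n) with hx
  have hxsq : x ^ 2 = 2 * Real.log n := Real.sq_sqrt (by linarith)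
  have hx1 : 1 ≤ x := by rw [hx, Real.one_le_sqrt]; linarith
  have h1 : (32 : ℝ) * Real.log n / D ^ 2 ≤ s := by
    refine le_trans (le_add_of_nonneg_right ?_) hs
    have := abs_nonneg (m - ν i)
    positivity
  have h2 : 8 * (w * |m - ν i|) / D ≤ s :=
    le_trans (le_add_of_nonneg_left (by positivity)) hs
  rw [div_le_iff₀ (by positivity)] at h1
  rw [div_le_iff₀ hD] at h2
  have hp : 0 < w + s := by positivity
  have hub := gittinsIndex_le (ν := posteriorMean ν v h i) (m := n - t) (posteriorVar_pos hv h i)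
    (by lia) hx1 (by
      rw [hxsq, mul_div_cancel_left₀ _ two_ne_zero, Real.exp_log (by linarith)]
      exact_mod_cast Nat.sub_le n t)
  have hvx : √(posteriorVar v h i : ℝ) * x ≤ D / 4 := by
    rw [coe_posteriorVar, hx, ← Real.sqrt_mul (by positivity)]
    refine Real.sqrt_le_iff.2 ⟨by positivity, ?_⟩
    rw [inv_mul_le_iff₀ hp]
    nlinarith [sq_nonneg D]
  have hmean : m + D / 4 ≤ posteriorMean ν v h i := by
    rw [armIndex] at hidx; linarith
  rw [posteriorMean_eq, le_div_iff₀ hp] at hmean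
  have h3 : -(w * |m - ν i|) ≤ w * (m - ν i) := by
    rw [← mul_neg]; exact mul_le_mul_of_nonneg_left (neg_abs_le _) hw0.le
  have h4 : 0 ≤ w * D := by positivity
  nlinarith

/-- If the index of an arm is less than `z`, then there are at most `failureBound` rounds left. -/
lemma le_failureBound_of_armIndex_lt {K η : ℝ}
    (hK : ∀ (ν : ℝ) (v : ℝ≥0) (m : ℕ) (x : ℝ), 0 < v → 0 < x →
      gittinsIndex ν v m < ν + √v * x → (m : ℝ) ≤ K * (1 + 1 / v) * Real.exp (x ^ 2 / 2 + η * x))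
    {ν : Fin d → ℝ} {v : Fin d → ℝ≥0} (hv : ∀ i, 0 < v i)
    {n t : ℕ} (ht : t < n) (h : History d t) (i : Fin d) {z : ℝ} (hz : armIndex ν v n h i < z) :
    ((n - t : ℕ) : ℝ≥0∞) ≤ failureBound K η (ν i) (v i : ℝ)⁻¹ z (pulls h i) (rewardSum h i) := by
  set w := (v i : ℝ)⁻¹ with hw
  have hw0 : 0 < w := inv_pos.2 (by exact_mod_cast hv i)
  have hp : 0 < w + pulls h i := by positivity
  have hlow : posteriorMean ν v h i ≤ armIndex ν v n h i :=
    le_gittinsIndex (posteriorVar_pos hv h i) (by lia) (stoppingValue_self_nonneg (by lia))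
  have hmean : posteriorMean ν v h i < z := hlow.trans_lt hz
  have hsqrt : √(posteriorVar v h i : ℝ) = (√(w + pulls h i))⁻¹ := by
    rw [coe_posteriorVar, Real.sqrt_inv]
  -- The shortfall is exactly the `x` at which the bound `hK` is to be used.
  have hshort : posteriorMean ν v h i +
      √(posteriorVar v h i : ℝ) * shortfall (ν i) w z (pulls h i) (rewardSum h i) = z := by
    have e : ∀ a : ℝ, (√(w + pulls h i))⁻¹ * (a / √(w + pulls h i)) = a / (w + pulls h i) := by
      intro a
      rw [inv_mul_eq_div, div_div, Real.mul_self_sqrt hp.le]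
    rw [hsqrt, shortfall, posteriorMean_eq, e, ← hw, ← add_div, div_eq_iff hp.ne']
    ring
  have hpos : 0 < shortfall (ν i) w z (pulls h i) (rewardSum h i) := by
    refine div_pos ?_ (Real.sqrt_pos.2 hp)
    rw [posteriorMean_eq, div_lt_iff₀ hp] at hmean
    linarith
  have hb := hK _ _ (n - t) _ (posteriorVar_pos hv h i) hpos (by rw [hshort]; exact hz)
  rw [failureBound, if_pos hpos, ← ENNReal.ofReal_natCast]
  refine ENNReal.ofReal_le_ofReal ?_
  rwa [coe_posteriorVar, one_div, inv_inv] at hb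

/-- An arm is pulled for the `(s + 1)`-st time at most once, so the indicator of `B` serves as
potential, with no cost for waiting. -/
lemma sum_pull_at_level_le (π : Strategy d) (μ : Fin d → ℝ) (i : Fin d) (s n : ℕ) {B : Set ℝ}
    (hB : MeasurableSet B) :
    ∑ t ∈ Finset.range n, ∫⁻ h, (if pulls h i = s then
        B.indicator 1 (rewardSum h i) * π.act t h {i} else 0) ∂(historyLaw π μ t) ≤
      gaussianReal (s * μ i) s B := by
  have hBm : Measurable (B.indicator (1 : ℝ → ℝ≥0∞)) := measurable_one.indicator hB
  have h := sum_cost_le_of_potential π μ i s n (fun _ => B.indicator 1) (fun _ _ => 0)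
    (fun _ => B.indicator 1) (fun _ => hBm) (fun _ => measurable_const) (fun _ => hBm)
    (fun _ _ _ => by simp) (fun _ _ _ => le_rfl)
  rw [lintegral_indicator_one hB] at h
  refine le_trans (le_of_eq ?_) h
  refine Finset.sum_congr rfl fun t _ => lintegral_congr fun h => ?_
  congr 1
  have : (fun j : Fin d => if j = i then B.indicator (1 : ℝ → ℝ≥0∞) (rewardSum h i) else 0) =
      Set.indicator {i} fun _ => B.indicator (1 : ℝ → ℝ≥0∞) (rewardSum h i) := by
    ext j; by_cases hj : j = i <;> simp [hj]
  rw [this, lintegral_indicator_const (measurableSet_singleton i)]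

/-- At most `M` rounds `t < n` satisfy `n - t ≤ M`. As a potential, `min M (n - t)` pays `1` for
each of them. -/
lemma sum_failure_at_level_le (π : Strategy d) (μ : Fin d → ℝ) (i : Fin d) (s n : ℕ)
    {M : ℝ → ℝ≥0∞} (hM : Measurable M) :
    ∑ t ∈ Finset.range n, ∫⁻ h, (if pulls h i = s then
        (if ((n - t : ℕ) : ℝ≥0∞) ≤ M (rewardSum h i) then 1 else 0) else 0) ∂(historyLaw π μ t) ≤
      ∫⁻ y, M y ∂(gaussianReal (s * μ i) s) := by
  have hc : ∀ t, Measurable fun y => if ((n - t : ℕ) : ℝ≥0∞) ≤ M y then (1 : ℝ≥0∞) else 0 :=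
    fun t => Measurable.ite (measurableSet_le measurable_const hM) measurable_const measurable_const
  have h0 : ∀ t < n, ∀ y, (if ((n - t : ℕ) : ℝ≥0∞) ≤ M y then (1 : ℝ≥0∞) else 0) +
      min (M y) ((n - (t + 1) : ℕ) : ℝ≥0∞) ≤ min (M y) ((n - t : ℕ) : ℝ≥0∞) := by
    intro t ht y
    have e : ((n - t : ℕ) : ℝ≥0∞) = 1 + ((n - (t + 1) : ℕ) : ℝ≥0∞) := by
      rw [show n - t = 1 + (n - (t + 1)) by lia]; push_cast; rfl
    split_ifs with hle
    · rw [min_eq_right hle, e]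
      gcongr
      exact min_le_right _ _
    · rw [zero_add, e]
      exact min_le_min_left _ le_add_self
  have h := sum_cost_le_of_potential π μ i s n (fun t y => min (M y) ((n - t : ℕ) : ℝ≥0∞)) _ _
    (fun t => hM.min measurable_const) hc hc h0 (fun t ht y => le_self_add.trans (h0 t ht y))
  refine le_trans (le_of_eq ?_) (h.trans (lintegral_mono fun y => min_le_left _ _))
  refine Finset.sum_congr rfl fun t _ => lintegral_congr fun h => ?_
  congr 1
  simp

/-- A suboptimal arm is pulled at most `32 log n / Δ ^ 2` times, up to a bounded number. -/
lemma exists_lintegral_pulls_le {ν : Fin d → ℝ} {v : Fin d → ℝ≥0} (hv : ∀ i, 0 < v i)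
    (μ : Fin d → ℝ) {i : Fin d} (hi : 0 < gap μ i) :
    ∃ C : ℝ≥0∞, C ≠ ⊤ ∧ ∀ (n : ℕ) (π : Strategy d), 2 ≤ n → IsGittinsStrategy ν v n π →
      ∫⁻ h, (pulls h i : ℝ≥0∞) ∂(historyLaw π μ n) ≤
        ENNReal.ofReal (32 * Real.log n / gap μ i ^ 2) + C := by
  set D := gap μ i with hD
  have : Nonempty (Fin d) := ⟨i⟩
  obtain ⟨k, hk⟩ := exists_eq_ciSup_of_finite (f := μ)
  have hki : μ k = μ i + D := by rw [hD, gap, hk]; ring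
  -- The level is `ε = D / 2` below the optimal mean, and `η = ε / 2` is the rate at which the
  -- failure bounds are summable.
  obtain ⟨K, hK0, hK⟩ := exists_le_of_gittinsIndex_lt (η := D / 2 / 2) (by positivity)
  set c₁ : ℝ := 8 * ((v i : ℝ)⁻¹ * |μ i - ν i|) / D with hc₁
  have hc₁0 : 0 ≤ c₁ := by positivity
  have hvk : 0 < (v k : ℝ)⁻¹ := inv_pos.2 (by exact_mod_cast hv k)
  set F : ℝ≥0∞ := ∑' s : ℕ, ∫⁻ y, failureBound K (D / 2 / 2) (ν k) (v k : ℝ)⁻¹ (μ k - D / 2) s y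
    ∂(gaussianReal (s * μ k) s) with hF
  set G : ℝ≥0∞ := ∑' s : ℕ, ENNReal.ofReal (Real.exp (-(s * ((D / 8) ^ 2 / 2)))) with hG
  refine ⟨ENNReal.ofReal (c₁ + 1) + G + F, ENNReal.add_ne_top.2 ⟨ENNReal.add_ne_top.2
    ⟨ENNReal.ofReal_ne_top, tsum_exp_neg_ne_top (by positivity)⟩,
    tsum_lintegral_failureBound_ne_top hK0.le (by positivity) hvk⟩, ?_⟩
  intro n π hn hπ
  have hlog : 0 ≤ Real.log n := Real.log_natCast_nonneg n
  set ℓ : ℝ := 32 * Real.log n / D ^ 2 + c₁ with hℓ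
  have hℓ0 : 0 ≤ ℓ := by positivity
  set L := ⌈ℓ⌉₊ with hL
  -- The first `L` pulls are all counted; later ones only if the sum of rewards deviates.
  set B : ℕ → Set ℝ := fun s => if s < L then Set.univ else {y | s * (D / 8) ≤ y - s * μ i} with hB
  have hBm : ∀ s, MeasurableSet (B s) := by
    intro s
    simp only [hB]
    split_ifs
    · exact MeasurableSet.univ
    · exact measurableSet_le measurable_const (by fun_prop)
  have hround : ∀ t < n, ∀ h : History d t, π.act t h {i} ≤
      ∑ s ∈ Finset.range n, (if pulls h i = s then
        (B s).indicator 1 (rewardSum h i) * π.act t h {i} else 0) +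
      ∑ s ∈ Finset.range n, (if pulls h k = s then (if ((n - t : ℕ) : ℝ≥0∞) ≤
        failureBound K (D / 2 / 2) (ν k) (v k : ℝ)⁻¹ (μ k - D / 2) s (rewardSum h k)
        then 1 else 0) else 0) := by
    intro t ht h
    rw [Finset.sum_ite_eq, Finset.sum_ite_eq,
      if_pos (Finset.mem_range.2 ((pulls_le h i).trans_lt ht)),
      if_pos (Finset.mem_range.2 ((pulls_le h k).trans_lt ht))]
    by_cases hzero : π.act t h {i} = 0
    · rw [hzero]; exact zero_le
    -- An arm chosen with positive probability cannot lie in the null set of arms that do not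
    -- maximise the index.
    have hmax : ∀ j, armIndex ν v n h j ≤ armIndex ν v n h i := by
      by_contra hcon
      refine hzero (measure_mono_null ?_ (ae_iff.1 (hπ t ht h)))
      rintro _ rfl
      exact hcon
    by_cases hfail : armIndex ν v n h k < μ k - D / 2
    · rw [if_pos (le_failureBound_of_armIndex_lt hK hv ht h k hfail)]
      exact le_add_left prob_le_one
    · refine le_add_right ?_
      have hmem : rewardSum h i ∈ B (pulls h i) := by
        simp only [hB]
        split_ifs with hs
        · trivial
        · refine mul_le_rewardSum_sub_of_le_armIndex (ν := ν) hv hn ht h i hi ?_ ?_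
          · exact (Nat.le_ceil ℓ).trans (by exact_mod_cast not_lt.1 hs)
          · linarith [hmax k, not_lt.1 hfail]
      rw [Set.indicator_of_mem hmem, Pi.one_apply, one_mul]
  have hmeas1 : ∀ t s, Measurable fun h : History d t => (if pulls h i = s then
        (B s).indicator 1 (rewardSum h i) * π.act t h {i} else 0 : ℝ≥0∞) := fun t s =>
    Measurable.ite (measurableSet_eq_fun (measurable_pulls t i) measurable_const)
      (((measurable_one.indicator (hBm s)).comp (measurable_rewardSum t i)).mul
        (Kernel.measurable_coe _ (measurableSet_singleton i))) measurable_const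
  have hmeas2 : ∀ t s, Measurable fun h : History d t => (if pulls h k = s then
      (if ((n - t : ℕ) : ℝ≥0∞) ≤
        failureBound K (D / 2 / 2) (ν k) (v k : ℝ)⁻¹ (μ k - D / 2) s (rewardSum h k)
        then 1 else 0) else 0 : ℝ≥0∞) := fun t s =>
    Measurable.ite (measurableSet_eq_fun (measurable_pulls t k) measurable_const)
      (Measurable.ite (measurableSet_le measurable_const
        ((measurable_failureBound _ _ _ _ _ _).comp (measurable_rewardSum t k)))
        measurable_const measurable_const) measurable_const
  have hlevel : ∑ s ∈ Finset.range n, gaussianReal (s * μ i) s (B s) ≤ L + G := by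
    calc _ ≤ ∑ s ∈ Finset.range n, ((if s < L then 1 else 0) +
          ENNReal.ofReal (Real.exp (-(s * ((D / 8) ^ 2 / 2))))) := by
          refine Finset.sum_le_sum fun s _ => ?_
          by_cases hs : s < L
          · rw [if_pos hs]; exact le_add_right prob_le_one
          · rw [if_neg hs, zero_add]
            simp only [hB, if_neg hs]
            refine (gaussianReal_tail_le (μ i) s (a := D / 8) (by positivity)).trans (le_of_eq ?_)
            rw [mul_div_assoc]
      _ ≤ _ := by
          rw [Finset.sum_add_distrib]
          refine add_le_add ?_ (ENNReal.sum_le_tsum _)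
          rw [← Finset.sum_filter, Finset.sum_const, nsmul_one]
          norm_cast
          calc _ ≤ (Finset.range L).card := Finset.card_le_card fun s hs => by
                simpa using (Finset.mem_filter.1 hs).2
            _ = L := Finset.card_range L
  have hLle : (L : ℝ≥0∞) ≤ ENNReal.ofReal (32 * Real.log n / D ^ 2) + ENNReal.ofReal (c₁ + 1) := by
    rw [← ENNReal.ofReal_add (by positivity) (by positivity), ← ENNReal.ofReal_natCast]
    exact ENNReal.ofReal_le_ofReal ((Nat.ceil_lt_add_one hℓ0).le.trans (by rw [hℓ, add_assoc]))
  rw [lintegral_pulls]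
  calc _ ≤ ∑ t ∈ Finset.range n, ∫⁻ h,
      (∑ s ∈ Finset.range n, (if pulls h i = s then
        (B s).indicator 1 (rewardSum h i) * π.act t h {i} else 0) +
      ∑ s ∈ Finset.range n, (if pulls h k = s then (if ((n - t : ℕ) : ℝ≥0∞) ≤
        failureBound K (D / 2 / 2) (ν k) (v k : ℝ)⁻¹ (μ k - D / 2) s (rewardSum h k)
        then 1 else 0) else 0)) ∂(historyLaw π μ t) :=
        Finset.sum_le_sum fun t ht => lintegral_mono (hround t (Finset.mem_range.1 ht))
    _ = ∑ s ∈ Finset.range n, ∑ t ∈ Finset.range n, ∫⁻ h, (if pulls h i = s then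
        (B s).indicator 1 (rewardSum h i) * π.act t h {i} else 0) ∂(historyLaw π μ t) +
      ∑ s ∈ Finset.range n, ∑ t ∈ Finset.range n, ∫⁻ h, (if pulls h k = s then
        (if ((n - t : ℕ) : ℝ≥0∞) ≤
        failureBound K (D / 2 / 2) (ν k) (v k : ℝ)⁻¹ (μ k - D / 2) s (rewardSum h k)
        then 1 else 0) else 0) ∂(historyLaw π μ t) := by
        refine Eq.symm ((congrArg₂ (· + ·) Finset.sum_comm Finset.sum_comm).trans ?_)
        rw [← Finset.sum_add_distrib]
        refine Finset.sum_congr rfl fun t _ => ?_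
        rw [lintegral_add_left (Finset.measurable_sum _ fun s _ => hmeas1 t s),
          lintegral_finsetSum _ fun s _ => hmeas1 t s, lintegral_finsetSum _ fun s _ => hmeas2 t s]
    _ ≤ ∑ s ∈ Finset.range n, gaussianReal (s * μ i) s (B s) +
      ∑ s ∈ Finset.range n, ∫⁻ y,
        failureBound K (D / 2 / 2) (ν k) (v k : ℝ)⁻¹ (μ k - D / 2) s y
          ∂(gaussianReal (s * μ k) s) :=
        add_le_add (Finset.sum_le_sum fun s _ => sum_pull_at_level_le π μ i s n (hBm s))
          (Finset.sum_le_sum fun s _ =>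
            sum_failure_at_level_le π μ k s n (measurable_failureBound _ _ _ _ _ _))
    _ ≤ (L + G) + F := add_le_add hlevel (ENNReal.sum_le_tsum _)
    _ ≤ _ := by
        calc _ ≤ ENNReal.ofReal (32 * Real.log n / D ^ 2) + ENNReal.ofReal (c₁ + 1) + G + F := by
              gcongr
          _ = _ := by ring

/-- The regret is at most `32 log n ∑ 1 / Δ_i`, up to a bounded term. -/
lemma exists_regret_le {ν : Fin d → ℝ} {v : Fin d → ℝ≥0} (hv : ∀ i, 0 < v i) (μ : Fin d → ℝ) :
    ∃ C : ℝ, ∀ (n : ℕ) (π : Strategy d), 2 ≤ n → IsGittinsStrategy ν v n π →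
      regret π μ n ≤ 32 * (∑ i with 0 < gap μ i, 1 / gap μ i) * Real.log n + C := by
  have hex : ∀ i, ∃ C : ℝ, ∀ (n : ℕ) (π : Strategy d), 2 ≤ n → IsGittinsStrategy ν v n π →
      gap μ i * (∫⁻ h, (pulls h i : ℝ≥0∞) ∂(historyLaw π μ n)).toReal ≤
        32 * (if 0 < gap μ i then 1 / gap μ i else 0) * Real.log n + C := by
    intro i
    by_cases hi : 0 < gap μ i
    · obtain ⟨C, hC, hle⟩ := exists_lintegral_pulls_le (ν := ν) hv μ hi
      refine ⟨gap μ i * C.toReal, fun n π hn hπ => ?_⟩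
      have hlog : 0 ≤ Real.log n := Real.log_natCast_nonneg n
      have h1 := ENNReal.toReal_mono (ENNReal.add_ne_top.2 ⟨ENNReal.ofReal_ne_top, hC⟩)
        (hle n π hn hπ)
      rw [ENNReal.toReal_add ENNReal.ofReal_ne_top hC, ENNReal.toReal_ofReal (by positivity)] at h1
      rw [if_pos hi]
      refine (mul_le_mul_of_nonneg_left h1 hi.le).trans (le_of_eq ?_)
      field_simp
    · refine ⟨0, fun n π _ _ => ?_⟩
      rw [if_neg hi, le_antisymm (not_lt.1 hi) (gap_nonneg μ i)]
      simp
  choose C hC using hex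
  refine ⟨∑ i, C i, fun n π hn hπ => ?_⟩
  rw [regret_eq]
  refine (Finset.sum_le_sum fun i _ => hC i n π hn hπ).trans (le_of_eq ?_)
  rw [Finset.sum_add_distrib, ← Finset.sum_mul, ← Finset.mul_sum, Finset.sum_filter]

end Regret

end GaussianBandit

/-! ### Passage to the limit superior -/

theorem theorem3 :
    ∃ c : ℝ, 0 < c ∧
      ∀ (d : ℕ) (ν : Fin d → ℝ) (v : Fin d → ℝ≥0), (∀ i, 0 < v i) →
      ∀ π : ℕ → GaussianBandit.Strategy d,
        (∀ n, GaussianBandit.IsGittinsStrategy ν v n (π n)) →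
      ∀ μ : Fin d → ℝ,
        limsup (fun n : ℕ => ((GaussianBandit.regret (π n) μ n / Real.log n : ℝ) : EReal)) atTop ≤
          ((c * ∑ i with 0 < GaussianBandit.gap μ i, 1 / GaussianBandit.gap μ i : ℝ) : EReal) := by
  refine ⟨32, by norm_num, fun d ν v hv π hπ μ => ?_⟩
  obtain ⟨C, hC⟩ := GaussianBandit.exists_regret_le (ν := ν) hv μ
  set S := ∑ i with 0 < GaussianBandit.gap μ i, 1 / GaussianBandit.gap μ i
  have hlim : Tendsto (fun n : ℕ => ((32 * S + C / Real.log n : ℝ) : EReal)) atTop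
      (nhds ((32 * S : ℝ) : EReal)) := by
    refine (continuous_coe_real_ereal.tendsto _).comp ?_
    have h := (Real.tendsto_log_atTop.comp tendsto_natCast_atTop_atTop).const_div_atTop C
    simpa using h.const_add (32 * S)
  rw [← hlim.limsup_eq]
  refine limsup_le_limsup ?_
  filter_upwards [eventually_ge_atTop 2] with n hn
  have hn' : (2 : ℝ) ≤ n := by exact_mod_cast hn
  have hlog : 0 < Real.log n := Real.log_pos (by linarith)
  refine EReal.coe_le_coe_iff.2 ?_
  rw [div_le_iff₀ hlog, add_mul, div_mul_cancel₀ _ hlog.ne']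
  exact hC n (π n) hn (hπ n)
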